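/- Consider the control-affine system $$\dot x(t)=g(x(t),u(t),w(t)):=f(x(t),w(t))+G(x(t))u(t),$$ with $f:\mathbb R^{n_x}\times\mathbb R^{n_w}\to\mathbb R^{n_x}$ and $G:\mathbb R^{n_x}\to\mathbb R^{n_x\times n_u}$ twice continuously differentiable, control set $U\subseteq\mathbb R^{n_u}$ and disturbance set $W\subseteq\mathbb R^{n_w}$. For $q\in\mathbb R^n$ and a symmetric positive semidefinite $Q\in\mathbb S^n_+$ let $\mathcal E(q,Q)=\{q+Q^{1/2}v : v^\top v\le 1\}$ and $\mathcal E(Q)=\mathcal E(0,Q)$; $A\succeq B$ means that $A-B$ is symmetric positive semidefinite. **Robust forward invariant tube (RFIT).** A set-valued function $Y$ on $[t_1,t_2]$ with values in the subsets of $\mathbb R^{n_x}$ is an RFIT if there is a feedback law $\mu:[t_1,t_2]\times\mathbb R^{n_x}\to U$, jointly Borel measurable and integrable in $t$ for each fixed state, such that for every integrable disturbance $w:[t_1,t_2]\to W$, all $s\le s'$ in $[t_1,t_2]$ and every absolutely continuous $x$ on $[s,s']$ satisfying $\dot x(t)=f(x(t),w(t))+G(x(t))\mu(t,x(t))$ for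 a.e. $t\in[s,s']$: if $x(s)\in Y(s)$ then $x(s')\in Y(s')$. **Assumptions.** 1. $q_w\in\mathbb R^{n_w}$, $Q_w\in\mathbb S^{n_w}_+$, $q_u\in\mathbb R^{n_u}$, $Q_u\in\mathbb S^{n_u}_+$ satisfy $W\subseteq\mathcal E(q_w,Q_w)$ and $\mathcal E(q_u,Q_u)\subseteq U$. 2. The reference control $u_x:[t_1,t_2]\to U$ is integrable with $u_x(t)\in\mathcal E(q_u,Q_u)$ for all $t$. For some $\gamma:[t_1,t_2]\to(0,1]$, $$R_u(t)=[1-\gamma(t)]\,Q_u+[1-\gamma(t)^{-1}]\,[u_x(t)-q_u][u_x(t)-q_u]^\top\succeq 0\qquad(t\in[t_1,t_2]).$$ 3. $q_x:[t_1,t_2]\to\mathbb R^{n_x}$ and $Q_x:[t_1,t_2]\to\mathbb S^{n_x}_+$ are absolutely continuous. Put $$A(t)=\tfrac{\partial f}{\partial x}(q_x(t),q_w)+\tfrac{\partial G}{\partial x}(q_x(t))\,u_x(t),\qquad B(t)=\tfrac{\partial f}{\partial w}(q_x(t),q_w).$$ 4. Let the nominal control $\bar u$, from which control perturbations are measured,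 be either $\bar u=u_x$ or $\bar u\equiv q_u$, and put $$n(t,\xi,\omega,\nu)=g(q_x(t)+\xi,\ \bar u(t)+\nu,\ q_w+\omega)-g(q_x(t),u_x(t),q_w)-A(t)\xi-B(t)\omega-G(q_x(t)+\xi)\nu .$$ The function $\Omega_n:\mathbb R^{n_x}\times\mathbb S^{n_x}_+\to\mathbb S^{n_x}_+$ satisfies $n(t,\xi,\omega,\nu)\in\mathcal E(\Omega_n(q_x(t),Q_x(t)))$ for all $t\in[t_1,t_2]$, $\xi\in\mathcal E(Q_x(t))$, $\omega\in\mathcal E(Q_w)$, $\nu\in\mathcal E(Q_u)$. 5. Put $H(t,S_0,M)=Q_x(t)^{1/2}S_0R_u(t)^{1/2}M^\top+M R_u(t)^{1/2}S_0^\top Q_x(t)^{1/2}$ for $S_0,M\in\mathbb R^{n_x\times n_u}$. The function $\Omega_G:\mathbb R^{n_x}\times\mathbb S^{n_x}_+\times\mathbb S^{n_u}_+\times\mathbb R^{n_x\times n_u}\to\mathbb S^{n_x}_+$ satisfies $$\Omega_G(q_x(t),Q_x(t),R_u(t),S_0)\succeq H(t,S_0,G(\xi))-H(t,S_0,G(q_x(t)))$$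 for all $t\in[t_1,t_2]$, all $\xi\in\mathcal E(q_x(t),Q_x(t))$ and all $S_0$ with $S_0S_0^\top\preceq I$. **Theorem.** Suppose that for some functions $\lambda,\kappa:[t_1,t_2]\to(0,\infty)$ and $S:[t_1,t_2]\to\mathbb R^{n_x\times n_u}$ with $S(t)S(t)^\top\preceq I$, the following hold for a.e. $t\in[t_1,t_2]$ (arguments $t$ omitted): $$\dot q_x=f(q_x,q_w)+G(q_x)u_x,$$ $$\dot Q_x\succeq AQ_x+Q_xA^\top+Q_x^{1/2}SR_u^{1/2}G(q_x)^\top+G(q_x)R_u^{1/2}S^\top Q_x^{1/2}+\Big(\frac1\lambda+\frac1\kappa\Big)Q_x+\Omega_G(q_x,Q_x,R_u,S)+\lambda\,BQ_wB^\top+\kappa\,\Omega_n(q_x,Q_x).$$ Then $Y(t)=\mathcal E(q_x(t),Q_x(t))$ is an RFIT for the system on $[t_1,t_2]$. -/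

import Mathlib

open MeasureTheory Set
open scoped Matrix

namespace EllTube

noncomputable section

/-- `ℝⁿ` with the Euclidean norm. -/
abbrev Vec (n : ℕ) : Type := EuclideanSpace ℝ (Fin n)

/-- Real `m × n` matrices. -/
abbrev Mat (m n : ℕ) : Type := Matrix (Fin m) (Fin n) ℝ

/-- The matrix-vector product on Euclidean spaces. -/
def act {m n : ℕ} (M : Mat m n) (v : Vec n) : Vec m := Matrix.toEuclideanLin M v

open scoped MatrixOrder in
/-- The symmetric positive semidefinite square root of a positive semidefinite matrix. -/
def msqrt {n : ℕ} (Q : Mat n n) : Mat n n := CFC.sqrt Q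

/-- The Loewner order `A ⪯ B`: the difference `B - A` is symmetric positive semidefinite. -/
def Loewner {n : ℕ} (A B : Mat n n) : Prop := (B - A).PosSemidef

/-- The ellipsoid `{q + Q^{1/2} v : vᵀ v ≤ 1}`. -/
def ellipsoid {n : ℕ} (q : Vec n) (Q : Mat n n) : Set (Vec n) :=
  {y | ∃ v : Vec n, ‖v‖ ≤ 1 ∧ y = q + act (msqrt Q) v}

/-- The Jacobian matrix of `F` at `x`. -/
def jacobian {m n : ℕ} (F : Vec n → Vec m) (x : Vec n) : Mat m n :=
  Matrix.of fun i j => (fderiv ℝ F x (EuclideanSpace.single j 1)) i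

/-- The entrywise time derivative of a matrix-valued function. -/
def matDeriv {m n : ℕ} (Q : ℝ → Mat m n) (t : ℝ) : Mat m n :=
  Matrix.of fun i j => deriv (fun s => Q s i j) t

/-- Signals on `[t₁, t₂]`: Lebesgue-integrable functions with values in `Z`. -/
def IsSignal {n : ℕ} (t₁ t₂ : ℝ) (Z : Set (Vec n)) (u : ℝ → Vec n) : Prop :=
  IntegrableOn u (Icc t₁ t₂) ∧ ∀ t ∈ Icc t₁ t₂, u t ∈ Z

section System

variable {nx nu nw : ℕ}

/-- The right-hand side `g(x, u, w) = f(x, w) + G(x) u` of the control system. -/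
def rhs (f : Vec nx → Vec nw → Vec nx) (G : Vec nx → Mat nx nu)
    (x : Vec nx) (u : Vec nu) (w : Vec nw) : Vec nx :=
  f x w + act (G x) u

/-- `x` is a (Carathéodory) solution on `[s, s']` of the closed-loop system
`ẋ(t) = f(x(t), w(t)) + G(x(t)) μ(t, x(t))`. -/
def IsClosedLoopSolution (f : Vec nx → Vec nw → Vec nx) (G : Vec nx → Mat nx nu)
    (μ : ℝ → Vec nx → Vec nu) (w : ℝ → Vec nw) (s s' : ℝ) (x : ℝ → Vec nx) : Prop :=
  AbsolutelyContinuousOnInterval x s s' ∧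
    ∀ᵐ t : ℝ, t ∈ Icc s s' → HasDerivAt x (rhs f G (x t) (μ t (x t)) (w t)) t

/-- `μ` is an integrable feedback law on `[t₁, t₂]` with values in `U`: jointly Borel measurable,
and integrable in time for every fixed state. -/
def IsFeedback (U : Set (Vec nu)) (t₁ t₂ : ℝ) (μ : ℝ → Vec nx → Vec nu) : Prop :=
  Measurable (Function.uncurry μ) ∧
    (∀ ξ, IntegrableOn (fun t => μ t ξ) (Icc t₁ t₂)) ∧
    ∀ t ∈ Icc t₁ t₂, ∀ ξ, μ t ξ ∈ U

/-- `Y` is a robust forward invariant tube on `[t₁, t₂]`: one feedback law, independent of the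
disturbance, keeps every closed-loop solution that is in `Y` at some time `s` inside `Y` at all
later times `s'`, whatever the disturbance. -/
def IsRFIT (f : Vec nx → Vec nw → Vec nx) (G : Vec nx → Mat nx nu)
    (U : Set (Vec nu)) (W : Set (Vec nw)) (t₁ t₂ : ℝ) (Y : ℝ → Set (Vec nx)) : Prop :=
  ∃ μ : ℝ → Vec nx → Vec nu, IsFeedback U t₁ t₂ μ ∧
    ∀ w : ℝ → Vec nw, IsSignal t₁ t₂ W w →
      ∀ s ∈ Icc t₁ t₂, ∀ s' ∈ Icc t₁ t₂, s ≤ s' →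
        ∀ x : ℝ → Vec nx, IsClosedLoopSolution f G μ w s s' x → x s ∈ Y s → x s' ∈ Y s'

/-- `A = ∂f/∂x (q, q_w) + ∂G/∂x (q) u`. -/
def Amat (f : Vec nx → Vec nw → Vec nx) (G : Vec nx → Mat nx nu) (qw : Vec nw)
    (q : Vec nx) (u : Vec nu) : Mat nx nx :=
  jacobian (fun x => f x qw) q + jacobian (fun x => act (G x) u) q

/-- `B = ∂f/∂w (q, q_w)`. -/
def Bmat (f : Vec nx → Vec nw → Vec nx) (qw : Vec nw) (q : Vec nx) : Mat nx nw :=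
  jacobian (fun w => f q w) qw

/-- The nonlinear remainder `n(ξ, ω, ν)` at a time at which the nominal state is `q`, the reference
control is `u` and control perturbations are measured from `ubar`. It is what makes
`δ̇ = A δ + B ω + G(q + δ) ν + n(δ, ω, ν)` equivalent to `ẋ = f(x, w) + G(x) u'`, for `x = q + δ`,
`w = q_w + ω`, `u' = ubar + ν`, and `q̇ = f(q, q_w) + G(q) u`. -/
def remainder (f : Vec nx → Vec nw → Vec nx) (G : Vec nx → Mat nx nu) (qw : Vec nw)
    (q : Vec nx) (u ubar : Vec nu) (ξ : Vec nx) (ω : Vec nw) (ν : Vec nu) : Vec nx :=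
  (rhs f G (q + ξ) (ubar + ν) (qw + ω) - rhs f G q u qw)
    - (act (Amat f G qw q u) ξ + act (Bmat f qw q) ω + act (G (q + ξ)) ν)

/-- The shape matrix `(1 - γ) Q_u + (1 - γ⁻¹) (u - q_u) (u - q_u)ᵀ`. -/
def innerShape (qu : Vec nu) (Qu : Mat nu nu) (γ : ℝ) (u : Vec nu) : Mat nu nu :=
  (1 - γ) • Qu + (1 - γ⁻¹) • Matrix.vecMulVec (u - qu).ofLp (u - qu).ofLp

/-- `Q^{1/2} S R^{1/2} G₀ᵀ + G₀ R^{1/2} Sᵀ Q^{1/2}`. -/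
def controlTerm (Q : Mat nx nx) (S : Mat nx nu) (R : Mat nu nu) (G₀ : Mat nx nu) : Mat nx nx :=
  msqrt Q * S * msqrt R * G₀ᵀ + G₀ * msqrt R * Sᵀ * msqrt Q

/-- The right-hand side `Φ_g` of the matrix differential inequality; `A` is evaluated along the
reference control `u`. -/
def Phi (f : Vec nx → Vec nw → Vec nx) (G : Vec nx → Mat nx nu) (qw : Vec nw) (Qw : Mat nw nw)
    (Ωn : Vec nx → Mat nx nx → Mat nx nx)
    (ΩG : Vec nx → Mat nx nx → Mat nu nu → Mat nx nu → Mat nx nx)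
    (u : Vec nu) (q : Vec nx) (Q : Mat nx nx) (S : Mat nx nu) (R : Mat nu nu) (lam kap : ℝ) :
    Mat nx nx :=
  Amat f G qw q u * Q + Q * (Amat f G qw q u)ᵀ + controlTerm Q S R (G q)
    + (1 / lam + 1 / kap) • Q + ΩG q Q R S
    + lam • (Bmat f qw q * Qw * (Bmat f qw q)ᵀ) + kap • Ωn q Q

/-- `Ωn` is a nonlinearity bounder for the remainder along the tube. -/
def IsRemainderBounder (f : Vec nx → Vec nw → Vec nx) (G : Vec nx → Mat nx nu)
    (qw : Vec nw) (Qw : Mat nw nw) (Qu : Mat nu nu) (t₁ t₂ : ℝ) (ux ubar : ℝ → Vec nu)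
    (qx : ℝ → Vec nx) (Qx : ℝ → Mat nx nx) (Ωn : Vec nx → Mat nx nx → Mat nx nx) : Prop :=
  (∀ q Q, Q.PosSemidef → (Ωn q Q).PosSemidef) ∧
    ∀ t ∈ Icc t₁ t₂, ∀ ξ ∈ ellipsoid 0 (Qx t), ∀ ω ∈ ellipsoid 0 Qw, ∀ ν ∈ ellipsoid 0 Qu,
      remainder f G qw (qx t) (ux t) (ubar t) ξ ω ν ∈ ellipsoid 0 (Ωn (qx t) (Qx t))

/-- `ΩG` is a nonlinearity bounder for the input matrix `G` along the tube. -/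
def IsInputBounder (G : Vec nx → Mat nx nu) (t₁ t₂ : ℝ) (qx : ℝ → Vec nx) (Qx : ℝ → Mat nx nx)
    (Ru : ℝ → Mat nu nu) (ΩG : Vec nx → Mat nx nx → Mat nu nu → Mat nx nu → Mat nx nx) : Prop :=
  (∀ q Q R S, Q.PosSemidef → R.PosSemidef → (ΩG q Q R S).PosSemidef) ∧
    ∀ t ∈ Icc t₁ t₂, ∀ ξ ∈ ellipsoid (qx t) (Qx t), ∀ S₀ : Mat nx nu, Loewner (S₀ * S₀ᵀ) 1 →
      Loewner (controlTerm (Qx t) S₀ (Ru t) (G ξ) - controlTerm (Qx t) S₀ (Ru t) (G (qx t)))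
        (ΩG (qx t) (Qx t) (Ru t) S₀)

end System

end

end EllTube

/-! The feedback acts through the nearest point of the tube. If `p = q + Q z`, with `zᵀ Q z ≤ 1`, is
the point of the ellipsoid nearest to the state `x`, the control is `ubar + K z` for a
time-dependent gain `K`. Let `D(t)` be the distance from a closed-loop solution to the ellipsoid. At
almost every time, some curve through `p` stays in the moving ellipsoid and has velocity `g(p, u,
w)`, where `u` and `w` are the control and disturbance acting on `x` (`exists_curve_mem_ellipsoid`).
Hence `D' ≤ ‖g(x, u, w) - g(p, u, w)‖ ≤ L D`, and Grönwall's inequality keeps `D` at zero. No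
regularity of the feedback in `x` is used here.

Let `T` be the velocity of that curve relative to the center. The curve exists under two first order
conditions: `2 zᵀ T ≤ zᵀ Q' z` when `zᵀ Q z = 1`, and `T - Q' z` in the range of `Q`, which matters
when `Q` is singular. Both come from the matrix inequality tested on vectors: `contractingGain_gain`
turns it into a scalar inequality between support functions, where the weights `λ`, `κ` are those of
Young's inequality, and `ContractingGain.exists_act_eq` extracts the range condition by perturbing
kernel vectors of `Q`.

Two technical points shape the proof. Since `√(cᵀ Q c)` need not be absolutely continuous, neither
need `D` be. But the matrix inequality bounds `Q'` from below, so `D` is one-sided Lipschitz: its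
singular part can only decrease, and Grönwall survives (`eq_zero_of_antitoneOn_sub_of_ae_deriv_le`).
Secondly, `γ`, `λ`, `κ` and `S` are not assumed measurable, so `R^{1/2} Sᵀ Q^{1/2}` need not be a
measurable gain. It only shows that the set of suitable gains is nonempty. That set is cut out by
countably many inequalities affine in `K`, so `exists_measurable_selection` yields a measurable
gain; the same theorem selects `z`. -/

namespace EllTube

noncomputable section

/-! ### The matrix action -/

section Act

variable {l m n : ℕ}

lemma act_apply (M : Mat m n) (v : Vec n) (i : Fin m) : act M v i = ∑ j, M i j * v j := rfl

@[simp] lemma act_add (M : Mat m n) (v w : Vec n) : act M (v + w) = act M v + act M w :=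
  map_add _ _ _

@[simp] lemma act_sub (M : Mat m n) (v w : Vec n) : act M (v - w) = act M v - act M w :=
  map_sub _ _ _

@[simp] lemma act_smul (M : Mat m n) (a : ℝ) (v : Vec n) : act M (a • v) = a • act M v :=
  map_smul _ _ _

@[simp] lemma act_zero (M : Mat m n) : act M (0 : Vec n) = 0 := map_zero _

@[simp] lemma act_neg (M : Mat m n) (v : Vec n) : act M (-v) = -act M v := map_neg _ _

@[simp] lemma add_act (M N : Mat m n) (v : Vec n) : act (M + N) v = act M v + act N v := by
  simp [act]

@[simp] lemma sub_act (M N : Mat m n) (v : Vec n) : act (M - N) v = act M v - act N v := by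
  simp [act]

@[simp] lemma smul_act (a : ℝ) (M : Mat m n) (v : Vec n) : act (a • M) v = a • act M v := by
  simp [act]

@[simp] lemma one_act (v : Vec n) : act (1 : Mat n n) v = v := by
  simp [act]

lemma mul_act (M : Mat l m) (N : Mat m n) (v : Vec n) : act (M * N) v = act M (act N v) := by
  simp [act, Matrix.toLpLin_apply]

lemma inner_act (M : Mat m n) (x : Vec m) (v : Vec n) :
    inner ℝ x (act M v) = inner ℝ (act Mᵀ x) v := by
  simp only [PiLp.inner_apply, act_apply, RCLike.inner_apply, conj_trivial, Matrix.transpose_apply,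
    Finset.sum_mul, Finset.mul_sum]
  rw [Finset.sum_comm]
  exact Finset.sum_congr rfl fun i _ => Finset.sum_congr rfl fun j _ => by ring

lemma inner_vecMulVec_act (a c : Vec n) :
    inner ℝ c (act (Matrix.vecMulVec a.ofLp a.ofLp) c) = (inner ℝ c a) ^ 2 := by
  simp only [PiLp.inner_apply, act_apply, RCLike.inner_apply, conj_trivial,
    Matrix.vecMulVec_apply, sq, Finset.sum_mul, Finset.mul_sum]
  rw [Finset.sum_comm]
  exact Finset.sum_congr rfl fun i _ => Finset.sum_congr rfl fun j _ => by ring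

lemma continuous_act (M : Mat m n) : Continuous (act M) :=
  LinearMap.continuous_of_finiteDimensional (Matrix.toEuclideanLin M)

/-- The quadratic form of a square matrix. -/
def quad (Q : Mat n n) (c : Vec n) : ℝ := inner ℝ c (act Q c)

/-- The seminorm `√(cᵀ Q c)`, which is the support function of the ellipsoid `E(0, Q)`. -/
def supp (Q : Mat n n) (c : Vec n) : ℝ := √(quad Q c)

lemma quad_eq_sum (Q : Mat n n) (c : Vec n) : quad Q c = ∑ i, ∑ j, Q i j * (c i * c j) := by
  simp only [quad, PiLp.inner_apply, act_apply, RCLike.inner_apply, conj_trivial, Finset.sum_mul]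
  exact Finset.sum_congr rfl fun i _ => Finset.sum_congr rfl fun j _ => by ring

lemma quad_smul (Q : Mat n n) (a : ℝ) (c : Vec n) : quad Q (a • c) = a ^ 2 * quad Q c := by
  simp [quad, inner_smul_left, inner_smul_right]; ring

lemma continuous_quad (Q : Mat n n) : Continuous (quad Q) :=
  continuous_id.inner (continuous_act Q)

lemma continuous_supp (Q : Mat n n) : Continuous (supp Q) := (continuous_quad Q).sqrt

lemma supp_nonneg (Q : Mat n n) (c : Vec n) : 0 ≤ supp Q c := Real.sqrt_nonneg _

lemma supp_smul (Q : Mat n n) (a : ℝ) (c : Vec n) : supp Q (a • c) = |a| * supp Q c := by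
  rw [supp, quad_smul, Real.sqrt_mul (sq_nonneg a), Real.sqrt_sq_eq_abs, supp]

lemma quad_nonneg {Q : Mat n n} (hQ : Q.PosSemidef) (c : Vec n) : 0 ≤ quad Q c := by
  have := hQ.dotProduct_mulVec_nonneg c.ofLp
  rw [quad_eq_sum]
  simpa [dotProduct, Matrix.mulVec, Finset.mul_sum, mul_comm, mul_left_comm, mul_assoc] using this

lemma supp_sq {Q : Mat n n} (hQ : Q.PosSemidef) (c : Vec n) : supp Q c ^ 2 = quad Q c :=
  Real.sq_sqrt (quad_nonneg hQ c)

lemma transpose_eq {Q : Mat n n} (hQ : Q.PosSemidef) : Qᵀ = Q := by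
  simpa [Matrix.IsHermitian, Matrix.conjTranspose_eq_transpose_of_trivial] using hQ.isHermitian

lemma inner_act_comm {Q : Mat n n} (hQ : Q.PosSemidef) (x y : Vec n) :
    inner ℝ x (act Q y) = inner ℝ y (act Q x) := by
  rw [inner_act, transpose_eq hQ, real_inner_comm]

lemma quad_le_of_loewner {P Q : Mat n n} (h : Loewner P Q) (c : Vec n) : quad P c ≤ quad Q c := by
  have := quad_nonneg h c
  simpa [quad, inner_sub_right] using this

end Act

/-! ### Square roots and ellipsoids -/

section Ellipsoid

variable {n : ℕ} {Q : Mat n n}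

open scoped MatrixOrder in
lemma msqrt_posSemidef (Q : Mat n n) : (msqrt Q).PosSemidef :=
  Matrix.nonneg_iff_posSemidef.1 (CFC.sqrt_nonneg Q)

open scoped MatrixOrder in
lemma msqrt_mul_msqrt (hQ : Q.PosSemidef) : msqrt Q * msqrt Q = Q :=
  CFC.sqrt_mul_sqrt_self Q hQ.nonneg

lemma act_msqrt_msqrt (hQ : Q.PosSemidef) (v : Vec n) :
    act (msqrt Q) (act (msqrt Q) v) = act Q v := by
  rw [← mul_act, msqrt_mul_msqrt hQ]

lemma quad_eq_norm_sq (hQ : Q.PosSemidef) (c : Vec n) : quad Q c = ‖act (msqrt Q) c‖ ^ 2 := by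
  rw [quad, ← act_msqrt_msqrt hQ, inner_act, transpose_eq (msqrt_posSemidef Q),
    real_inner_self_eq_norm_sq]

lemma supp_eq_norm (hQ : Q.PosSemidef) (c : Vec n) : supp Q c = ‖act (msqrt Q) c‖ := by
  rw [supp, quad_eq_norm_sq hQ, Real.sqrt_sq (norm_nonneg _)]

lemma act_eq_zero_of_supp (hQ : Q.PosSemidef) {c : Vec n} (h : supp Q c = 0) : act Q c = 0 := by
  rw [supp_eq_norm hQ, norm_eq_zero] at h
  rw [← act_msqrt_msqrt hQ, h, act_zero]

lemma supp_eq_zero {c : Vec n} (h : act Q c = 0) : supp Q c = 0 := by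
  simp [supp, quad, h]

lemma act_msqrt_eq_zero (hQ : Q.PosSemidef) {c : Vec n} (h : act Q c = 0) :
    act (msqrt Q) c = 0 := by
  rw [← norm_eq_zero, ← supp_eq_norm hQ, supp_eq_zero h]

lemma supp_add_le (hQ : Q.PosSemidef) (x y : Vec n) : supp Q (x + y) ≤ supp Q x + supp Q y := by
  simp only [supp_eq_norm hQ, act_add]
  exact norm_add_le _ _

/-- A vector orthogonal to the kernel of a symmetric matrix is in its range. -/
lemma exists_act_eq_of_orthogonal_ker (hQ : Q.PosSemidef) {y : Vec n}
    (h : ∀ c, act Q c = 0 → inner ℝ c y = 0) : ∃ z, act Q z = y := by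
  set R : Submodule ℝ (Vec n) := LinearMap.range (Matrix.toEuclideanLin Q)
  have hy : y ∈ Rᗮᗮ := by
    rw [Submodule.mem_orthogonal]
    intro c hc
    refine h c ?_
    rw [Submodule.mem_orthogonal] at hc
    have h0 := hc (act Q (act Q c)) ⟨_, rfl⟩
    rw [real_inner_comm, inner_act, transpose_eq hQ, real_inner_self_eq_norm_sq] at h0
    exact norm_eq_zero.1 (pow_eq_zero_iff two_ne_zero |>.1 h0)
  rw [Submodule.orthogonal_orthogonal] at hy
  exact hy

/-- The component of `v` orthogonal to the range of `Q^{1/2}` is killed by `Q^{1/2}`, so `v` may be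
taken of the form `Q^{1/2} z`. This parametrization involves `Q` alone, so a moving ellipsoid can be
followed without differentiating a square root. -/
lemma mem_ellipsoid_iff (hQ : Q.PosSemidef) {q y : Vec n} :
    y ∈ ellipsoid q Q ↔ ∃ z, supp Q z ≤ 1 ∧ y = q + act Q z := by
  constructor
  · rintro ⟨v, hv, rfl⟩
    set R : Submodule ℝ (Vec n) := LinearMap.range (Matrix.toEuclideanLin (msqrt Q))
    obtain ⟨z, hz⟩ : R.starProjection v ∈ R := Submodule.starProjection_apply_mem R v
    have hz' : act (msqrt Q) z = R.starProjection v := hz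
    refine ⟨z, ?_, ?_⟩
    · rw [supp_eq_norm hQ, hz']
      exact (R.norm_starProjection_apply_le v).trans hv
    · congr 1
      rw [← act_msqrt_msqrt hQ, hz', ← sub_eq_zero, ← act_sub, ← norm_eq_zero,
        ← sq_eq_zero_iff, ← real_inner_self_eq_norm_sq, inner_act,
        transpose_eq (msqrt_posSemidef Q)]
      exact Submodule.inner_right_of_mem_orthogonal (K := R) ⟨_, rfl⟩
        (Submodule.sub_starProjection_mem_orthogonal v)
  · rintro ⟨z, hz, rfl⟩
    exact ⟨act (msqrt Q) z, by rwa [← supp_eq_norm hQ], by rw [act_msqrt_msqrt hQ]⟩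

lemma inner_sub_le_supp (hQ : Q.PosSemidef) {q y : Vec n} (hy : y ∈ ellipsoid q Q) (c : Vec n) :
    inner ℝ c (y - q) ≤ supp Q c := by
  obtain ⟨v, hv, rfl⟩ := hy
  rw [add_sub_cancel_left, inner_act, transpose_eq (msqrt_posSemidef Q), supp_eq_norm hQ]
  exact (real_inner_le_norm _ _).trans (mul_le_of_le_one_right (norm_nonneg _) hv)

lemma isCompact_ellipsoid (q : Vec n) (Q : Mat n n) : IsCompact (ellipsoid q Q) := by
  have : ellipsoid q Q = (fun v => q + act (msqrt Q) v) '' Metric.closedBall 0 1 := by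
    ext y
    simp only [ellipsoid, mem_ofPred_eq, mem_image, Metric.mem_closedBall, dist_zero_right]
    exact exists_congr fun v => and_congr_right fun _ => eq_comm
  rw [this]
  exact (isCompact_closedBall _ _).image (continuous_const.add (continuous_act _))

lemma convex_ellipsoid (q : Vec n) (Q : Mat n n) : Convex ℝ (ellipsoid q Q) := by
  rintro _ ⟨v, hv, rfl⟩ _ ⟨w, hw, rfl⟩ a b ha hb hab
  refine ⟨a • v + b • w, ?_, ?_⟩
  · calc ‖a • v + b • w‖ ≤ a * ‖v‖ + b * ‖w‖ := by
          refine (norm_add_le _ _).trans ?_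
          rw [norm_smul, norm_smul, Real.norm_of_nonneg ha, Real.norm_of_nonneg hb]
      _ ≤ a * 1 + b * 1 := by gcongr
      _ = 1 := by linarith
  · simp only [act_add, act_smul, smul_add]
    rw [add_add_add_comm, ← add_smul, hab, one_smul]

lemma center_mem_ellipsoid (q : Vec n) (Q : Mat n n) : q ∈ ellipsoid q Q := ⟨0, by simp⟩

lemma add_mem_ellipsoid_iff {q ξ : Vec n} : q + ξ ∈ ellipsoid q Q ↔ ξ ∈ ellipsoid 0 Q := by
  simp [ellipsoid]

/-- The outer normal `x - p` at a nearest point `p` of an ellipsoid attains the support function. -/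
lemma supp_le_of_nearest (hQ : Q.PosSemidef) {q x p : Vec n} (hp : p ∈ ellipsoid q Q)
    (hmin : ∀ y ∈ ellipsoid q Q, ‖x - p‖ ≤ ‖x - y‖) :
    supp Q (x - p) ≤ inner ℝ (x - p) (p - q) := by
  have : Nonempty (ellipsoid q Q) := ⟨⟨p, hp⟩⟩
  have hinf : ‖x - p‖ = ⨅ w : ellipsoid q Q, ‖x - w‖ :=
    le_antisymm (le_ciInf fun w => hmin w w.2)
      (ciInf_le (f := fun w : ellipsoid q Q => ‖x - w‖)
        ⟨0, by rintro _ ⟨w, rfl⟩; exact norm_nonneg _⟩ ⟨p, hp⟩)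
  have h := (norm_eq_iInf_iff_real_inner_le_zero (convex_ellipsoid q Q) hp).1 hinf
  set d := x - p
  rcases eq_or_ne (act (msqrt Q) d) 0 with h0 | h0
  · rw [supp_eq_norm hQ, h0, norm_zero]
    have := h q (center_mem_ellipsoid q Q)
    rw [← neg_sub p q, inner_neg_right] at this
    linarith
  · have hne : ‖act (msqrt Q) d‖ ≠ 0 := by simpa using h0
    -- The tested point is the one where the ellipsoid attains its support function in direction
    -- `d`.
    have := h (q + act (msqrt Q) (‖act (msqrt Q) d‖⁻¹ • act (msqrt Q) d))
      ⟨_, by simp [norm_smul, hne], rfl⟩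
    rw [show ∀ a : Vec n, q + a - p = a - (p - q) from fun a => by abel, inner_sub_right,
      inner_act, transpose_eq (msqrt_posSemidef Q), inner_smul_right,
      real_inner_self_eq_norm_sq, sq, inv_mul_cancel_left₀ hne] at this
    rw [supp_eq_norm hQ]; linarith

lemma exists_nearest_ellipsoid (q x : Vec n) (Q : Mat n n) :
    ∃ p ∈ ellipsoid q Q, ∀ y ∈ ellipsoid q Q, ‖x - p‖ ≤ ‖x - y‖ := by
  obtain ⟨p, hp, h⟩ := (isCompact_ellipsoid q Q).exists_isMinOn ⟨q, center_mem_ellipsoid q Q⟩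
    (f := fun y => ‖x - y‖) (by fun_prop)
  exact ⟨p, hp, fun y hy => h hy⟩

/-- Separation: testing with the outer normal at the nearest point forces that normal to vanish. -/
lemma mem_ellipsoid_of_forall_inner_le (hQ : Q.PosSemidef) {q y : Vec n}
    (h : ∀ c, inner ℝ c (y - q) ≤ supp Q c) : y ∈ ellipsoid q Q := by
  obtain ⟨p, hp, hmin⟩ := exists_nearest_ellipsoid q y Q
  have h1 := supp_le_of_nearest hQ hp hmin
  have h2 := h (y - p)
  have h3 : inner ℝ (y - p) (y - p) ≤ (0 : ℝ) := by
    have : y - p = (y - q) - (p - q) := by abel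
    nth_rw 2 [this]
    rw [inner_sub_right]; linarith
  have h4 : y - p = 0 := real_inner_self_nonpos.1 h3
  rw [sub_eq_zero.1 h4]; exact hp

end Ellipsoid

/-! ### The linear gain at a fixed time -/

section Gain

variable {nx nu nw : ℕ}

/-- The linear gain `R^{1/2} Sᵀ Q^{1/2}`. -/
def gain (Q : Mat nx nx) (S : Mat nx nu) (R : Mat nu nu) : Mat nu nx := msqrt R * Sᵀ * msqrt Q

lemma norm_act_transpose_le {S : Mat nx nu} (hS : Loewner (S * Sᵀ) 1) (v : Vec nx) :
    ‖act Sᵀ v‖ ≤ ‖v‖ := by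
  have h := quad_le_of_loewner hS v
  rw [quad, quad, mul_act, inner_act, one_act, real_inner_self_eq_norm_sq,
    real_inner_self_eq_norm_sq] at h
  exact le_of_sq_le_sq h (norm_nonneg _)

/-- Cauchy–Schwarz after moving `R^{1/2}` onto `e`; the factor `Sᵀ` is a contraction. -/
lemma inner_gain_le {Q : Mat nx nx} (hQ : Q.PosSemidef) {S : Mat nx nu}
    (hS : Loewner (S * Sᵀ) 1) {R : Mat nu nu} (hR : R.PosSemidef) (e : Vec nu) (c : Vec nx) :
    inner ℝ e (act (gain Q S R) c) ≤ supp Q c * supp R e := by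
  rw [gain, mul_act, mul_act, inner_act, transpose_eq (msqrt_posSemidef R), mul_comm,
    supp_eq_norm hQ, supp_eq_norm hR]
  exact (real_inner_le_norm _ _).trans
    (mul_le_mul_of_nonneg_left (norm_act_transpose_le hS _) (norm_nonneg _))

lemma quad_controlTerm (Q : Mat nx nx) (S : Mat nx nu) (R : Mat nu nu) (G₀ : Mat nx nu)
    (c : Vec nx) :
    quad (controlTerm Q S R G₀) c = 2 * inner ℝ c (act G₀ (act (gain Q S R) c)) := by
  have h : inner ℝ c (act (msqrt Q * S * msqrt R * G₀ᵀ) c) =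
      inner ℝ c (act (G₀ * msqrt R * Sᵀ * msqrt Q) c) := by
    rw [inner_act, real_inner_comm]
    simp only [Matrix.transpose_mul, Matrix.transpose_transpose,
      transpose_eq (msqrt_posSemidef Q), transpose_eq (msqrt_posSemidef R), Matrix.mul_assoc]
  rw [quad, controlTerm, add_act, inner_add_right, h, gain]
  simp only [mul_act]
  ring

lemma quad_innerShape (qu : Vec nu) (Qu : Mat nu nu) (γ : ℝ) (u e : Vec nu) :
    quad (innerShape qu Qu γ u) e =
      (1 - γ) * quad Qu e + (1 - γ⁻¹) * (inner ℝ e (u - qu)) ^ 2 := by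
  rw [innerShape, quad, add_act, smul_act, smul_act, inner_add_right, inner_smul_right,
    inner_smul_right, inner_vecMulVec_act, quad]

lemma supp_innerShape_le {qu : Vec nu} {Qu : Mat nu nu} (hQu : Qu.PosSemidef) {γ : ℝ} (hγ : 0 < γ)
    (hγ' : γ ≤ 1) (u e : Vec nu) : supp (innerShape qu Qu γ u) e ≤ supp Qu e := by
  refine Real.sqrt_le_sqrt ?_
  rw [quad_innerShape]
  have h1 : 1 ≤ γ⁻¹ := (one_le_inv₀ hγ).2 hγ'
  nlinarith [quad_nonneg hQu e, sq_nonneg (inner ℝ e (u - qu) : ℝ)]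

/-- In terms of support functions: `E(u, R) ⊆ E(qu, Qu)` for the inner shape matrix `R`. -/
lemma inner_add_supp_innerShape_le {qu : Vec nu} {Qu : Mat nu nu} (hQu : Qu.PosSemidef) {γ : ℝ}
    (hγ : 0 < γ) (hγ' : γ ≤ 1) {u : Vec nu} (hu : u ∈ ellipsoid qu Qu)
    (hR : (innerShape qu Qu γ u).PosSemidef) (e : Vec nu) :
    inner ℝ e (u - qu) + supp (innerShape qu Qu γ u) e ≤ supp Qu e := by
  have hr := supp_sq hR e
  have hs := supp_sq hQu e
  have hr0 := supp_nonneg (innerShape qu Qu γ u) e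
  have hs0 := supp_nonneg Qu e
  have hle := inner_sub_le_supp hQu hu e
  rw [quad_innerShape, ← hs] at hr
  set r := supp (innerShape qu Qu γ u) e
  set s := supp Qu e
  set a : ℝ := inner ℝ e (u - qu)
  -- For `γ = 1` the inner shape matrix is zero; otherwise `γ (1 - γ)` is positive and can be
  -- cancelled at the end.
  rcases eq_or_lt_of_le hγ' with rfl | hlt
  · have : r = 0 := by simpa using hr
    linarith
  · refine abs_le_of_sq_le_sq' ?_ hs0 |>.2
    have hr' : γ * r ^ 2 = (1 - γ) * (γ * s ^ 2 - a ^ 2) := by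
      rw [hr]; field_simp; ring
    have hpos : 0 < γ * (1 - γ) := mul_pos hγ (by linarith)
    have h2 : γ * (1 - γ) * s ^ 2 = γ * r ^ 2 + (1 - γ) * a ^ 2 := by linarith
    have h3 : γ * (1 - γ) * (a + r) ^ 2 ≤ γ * (1 - γ) * s ^ 2 := by
      rw [h2]; nlinarith [sq_nonneg (γ * r - (1 - γ) * a)]
    exact le_of_mul_le_mul_left h3 hpos

/-- The drift relative to the center of the tube, whose velocity is `v`, under the nominal
control `ubar`. -/
def drift (f : Vec nx → Vec nw → Vec nx) (G : Vec nx → Mat nx nu) (ubar : Vec nu) (v : Vec nx)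
    (p : Vec nx) (w : Vec nw) : Vec nx :=
  rhs f G p ubar w - v

/-- `K` is an admissible gain: `ubar + K z` is an admissible control for every `z` with
`zᵀ Q z ≤ 1`. -/
def AdmissibleGain (qu : Vec nu) (Qu : Mat nu nu) (Q : Mat nx nx) (ubar : Vec nu)
    (K : Mat nu nx) : Prop :=
  ∀ (c : Vec nx) (e : Vec nu),
    supp Q c * inner ℝ e (ubar - qu) + inner ℝ e (act K c) ≤ supp Q c * supp Qu e

/-- The gain `K` makes the ellipsoid with shape matrix `Q` and shape velocity `Q'` contracting. -/
def ContractingGain (f : Vec nx → Vec nw → Vec nx) (G : Vec nx → Mat nx nu) (W : Set (Vec nw))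
    (q : Vec nx) (Q A Q' : Mat nx nx) (ubar : Vec nu) (v : Vec nx) (K : Mat nu nx) : Prop :=
  ∀ c : Vec nx, ∀ p ∈ ellipsoid q Q, ∀ w ∈ W,
    2 * inner ℝ c (act A (act Q c)) + 2 * inner ℝ c (act (G p) (act K c))
      + 2 * supp Q c * inner ℝ c (drift f G ubar v p w - act A (p - q)) ≤ quad Q' c

/-- The drift is linear, up to vectors in the range of `Q`. -/
def DriftCompatible (f : Vec nx → Vec nw → Vec nx) (G : Vec nx → Mat nx nu) (W : Set (Vec nw))
    (q : Vec nx) (Q A : Mat nx nx) (ubar : Vec nu) (v : Vec nx) : Prop :=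
  ∀ c : Vec nx, act Q c = 0 → ∀ p ∈ ellipsoid q Q, ∀ w ∈ W,
    inner ℝ c (drift f G ubar v p w - act A (p - q)) = 0

/-- For `ubar = u` this rests on the inclusion of `E(u, R)` in `E(qu, Qu)`; for `ubar = qu` the
weaker comparison of support functions `supp R ≤ supp Qu` is enough. -/
lemma admissibleGain_gain {qu : Vec nu} {Qu : Mat nu nu} (hQu : Qu.PosSemidef) {γ : ℝ} (hγ : 0 < γ)
    (hγ' : γ ≤ 1) {u ubar : Vec nu} (hu : u ∈ ellipsoid qu Qu) (hubar : ubar = u ∨ ubar = qu)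
    (hR : (innerShape qu Qu γ u).PosSemidef) {Q : Mat nx nx} (hQ : Q.PosSemidef)
    {S : Mat nx nu} (hS : Loewner (S * Sᵀ) 1) :
    AdmissibleGain qu Qu Q ubar (gain Q S (innerShape qu Qu γ u)) := by
  intro c e
  have h := inner_gain_le hQ hS hR e c
  have h0 := supp_nonneg Q c
  rcases hubar with rfl | rfl
  · have := mul_le_mul_of_nonneg_left (inner_add_supp_innerShape_le hQu hγ hγ' hu hR e) h0
    linarith [mul_add (supp Q c) (inner ℝ e (ubar - qu)) (supp (innerShape qu Qu γ ubar) e)]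
  · have := mul_le_mul_of_nonneg_left (supp_innerShape_le hQu hγ hγ' u e (qu := ubar)) h0
    simp only [sub_self, inner_zero_right, mul_zero, zero_add]
    linarith

lemma quad_Phi (f : Vec nx → Vec nw → Vec nx) (G : Vec nx → Mat nx nu) (qw : Vec nw)
    (Qw : Mat nw nw) (Ωn : Vec nx → Mat nx nx → Mat nx nx)
    (ΩG : Vec nx → Mat nx nx → Mat nu nu → Mat nx nu → Mat nx nx)
    (u : Vec nu) (q : Vec nx) {Q : Mat nx nx} (hQ : Q.PosSemidef) (S : Mat nx nu) (R : Mat nu nu)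
    (lam kap : ℝ) (c : Vec nx) :
    quad (Phi f G qw Qw Ωn ΩG u q Q S R lam kap) c =
      2 * inner ℝ c (act (Amat f G qw q u) (act Q c))
        + 2 * inner ℝ c (act (G q) (act (gain Q S R) c)) + (1 / lam + 1 / kap) * quad Q c
        + quad (ΩG q Q R S) c + lam * quad Qw (act (Bmat f qw q)ᵀ c) + kap * quad (Ωn q Q) c := by
  have h : inner ℝ c (act Q (act (Amat f G qw q u)ᵀ c)) =
      inner ℝ c (act (Amat f G qw q u) (act Q c)) := by
    rw [inner_act_comm hQ, ← inner_act]
  rw [← quad_controlTerm]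
  simp only [quad, Phi, add_act, smul_act, inner_add_right, inner_smul_right, mul_act, h]
  rw [inner_act _ c (act Qw _)]
  ring

/-- Control enters affinely and `G(q + ξ) ν` is subtracted in full, so the remainder does not depend
on `ν`; its value at `ν = 0` carries everything. -/
lemma drift_sub_eq (f : Vec nx → Vec nw → Vec nx) (G : Vec nx → Mat nx nu) (qw : Vec nw)
    (q : Vec nx) (u ubar : Vec nu) (p : Vec nx) (w : Vec nw) :
    drift f G ubar (rhs f G q u qw) p w - act (Amat f G qw q u) (p - q) =
      act (Bmat f qw q) (w - qw) + remainder f G qw q u ubar (p - q) (w - qw) 0 := by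
  simp only [drift, remainder, act_zero, add_zero, add_sub_cancel]
  abel

/-! ### From the matrix differential inequality to conditions on the gain -/

section Inequality

variable {f : Vec nx → Vec nw → Vec nx} {G : Vec nx → Mat nx nu} {qw : Vec nw} {Qw : Mat nw nw}
  {Ωn : Vec nx → Mat nx nx → Mat nx nx}
  {ΩG : Vec nx → Mat nx nx → Mat nu nu → Mat nx nu → Mat nx nx}
  {u ubar : Vec nu} {q : Vec nx} {Q Q' : Mat nx nx} {S : Mat nx nu} {R : Mat nu nu} {lam kap : ℝ}

/-- Disturbance and remainder in terms of support functions. -/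
lemma inner_drift_sub_le (hQw : Qw.PosSemidef) (hΩn : (Ωn q Q).PosSemidef)
    (hn : ∀ ξ ∈ ellipsoid 0 Q, ∀ ω ∈ ellipsoid 0 Qw,
      remainder f G qw q u ubar ξ ω 0 ∈ ellipsoid 0 (Ωn q Q))
    {p : Vec nx} (hp : p ∈ ellipsoid q Q) {w : Vec nw} (hw : w ∈ ellipsoid qw Qw) (c : Vec nx) :
    inner ℝ c (drift f G ubar (rhs f G q u qw) p w - act (Amat f G qw q u) (p - q)) ≤
      supp Qw (act (Bmat f qw q)ᵀ c) + supp (Ωn q Q) c := by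
  rw [drift_sub_eq, inner_add_right]
  have hp' : p - q ∈ ellipsoid 0 Q := add_mem_ellipsoid_iff.1 (by rwa [add_sub_cancel])
  have hw' : w - qw ∈ ellipsoid 0 Qw := add_mem_ellipsoid_iff.1 (by rwa [add_sub_cancel])
  refine add_le_add ?_ ?_
  · rw [inner_act]
    exact inner_sub_le_supp hQw hw _
  · have := inner_sub_le_supp hΩn (hn _ hp' _ hw') c
    rwa [sub_zero] at this

lemma two_mul_mul_le_of_pos (s a : ℝ) {l : ℝ} (hl : 0 < l) :
    2 * s * a ≤ 1 / l * s ^ 2 + l * a ^ 2 := by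
  have h : 1 / l * s ^ 2 + l * a ^ 2 - 2 * s * a = l * (s / l - a) ^ 2 := by
    field_simp
    ring
  nlinarith [mul_nonneg hl.le (sq_nonneg (s / l - a))]

/-- Young's inequality with weights `λ` and `κ` splits the products of `supp Q c` with the
disturbance and remainder bounds into exactly the corresponding terms of `Phi`; the input bounder
pays for replacing `G(q)` by `G(p)`. -/
lemma contractingGain_gain (hQ : Q.PosSemidef) (hQw : Qw.PosSemidef) (hΩn : (Ωn q Q).PosSemidef)
    (hn : ∀ ξ ∈ ellipsoid 0 Q, ∀ ω ∈ ellipsoid 0 Qw,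
      remainder f G qw q u ubar ξ ω 0 ∈ ellipsoid 0 (Ωn q Q))
    (hΩG : ∀ p ∈ ellipsoid q Q,
      Loewner (controlTerm Q S R (G p) - controlTerm Q S R (G q)) (ΩG q Q R S))
    (hlam : 0 < lam) (hkap : 0 < kap)
    (hineq : Loewner (Phi f G qw Qw Ωn ΩG u q Q S R lam kap) Q') :
    ContractingGain f G (ellipsoid qw Qw) q Q (Amat f G qw q u) Q' ubar (rhs f G q u qw)
      (gain Q S R) := by
  intro c p hp w hw
  have h1 := quad_le_of_loewner hineq c
  rw [quad_Phi _ _ _ _ _ _ _ _ hQ] at h1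
  have h2 := quad_le_of_loewner (hΩG p hp) c
  have h2' : quad (controlTerm Q S R (G p) - controlTerm Q S R (G q)) c =
      quad (controlTerm Q S R (G p)) c - quad (controlTerm Q S R (G q)) c := by
    simp [quad, inner_sub_right]
  rw [h2', quad_controlTerm, quad_controlTerm] at h2
  have h3 := inner_drift_sub_le hQw hΩn hn hp hw c
  have h4 := two_mul_mul_le_of_pos (supp Q c) (supp Qw (act (Bmat f qw q)ᵀ c)) hlam
  have h5 := two_mul_mul_le_of_pos (supp Q c) (supp (Ωn q Q) c) hkap
  rw [supp_sq hQ, supp_sq hQw] at h4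
  rw [supp_sq hQ, supp_sq hΩn] at h5
  have h6 := mul_le_mul_of_nonneg_left h3 (mul_nonneg zero_le_two (supp_nonneg Q c))
  rw [mul_add] at h6
  linarith [add_mul (1 / lam) (1 / kap) (quad Q c)]

/-- On the kernel of `Q` the matrix inequality reduces to a sum of nonnegative terms being at most
zero. Disturbance and remainder therefore have zero support in direction `c`, and using `-c` as well
turns the inequality into an equality. -/
lemma driftCompatible_of_loewner (hQ : Q.PosSemidef) (hQw : Qw.PosSemidef)
    (hΩn : (Ωn q Q).PosSemidef)
    (hn : ∀ ξ ∈ ellipsoid 0 Q, ∀ ω ∈ ellipsoid 0 Qw,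
      remainder f G qw q u ubar ξ ω 0 ∈ ellipsoid 0 (Ωn q Q))
    (hΩG : (ΩG q Q R S).PosSemidef)
    (hlam : 0 < lam) (hkap : 0 < kap)
    (hineq : Loewner (Phi f G qw Qw Ωn ΩG u q Q S R lam kap) Q')
    (hQ' : ∀ c, act Q c = 0 → quad Q' c = 0) :
    DriftCompatible f G (ellipsoid qw Qw) q Q (Amat f G qw q u) ubar (rhs f G q u qw) := by
  have key : ∀ c : Vec nx, act Q c = 0 → ∀ p ∈ ellipsoid q Q, ∀ w ∈ ellipsoid qw Qw,
      inner ℝ c (drift f G ubar (rhs f G q u qw) p w - act (Amat f G qw q u) (p - q)) ≤ 0 := by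
    intro c hc p hp w hw
    have h1 := quad_le_of_loewner hineq c
    have hK : act (gain Q S R) c = 0 := by rw [gain, mul_act, act_msqrt_eq_zero hQ hc, act_zero]
    rw [quad_Phi _ _ _ _ _ _ _ _ hQ, hQ' c hc, hK, hc, show quad Q c = 0 by simp [quad, hc]] at h1
    simp only [act_zero, inner_zero_right, mul_zero, zero_add] at h1
    have h2 := quad_nonneg hΩG c
    have h3 := quad_nonneg hQw (act (Bmat f qw q)ᵀ c)
    have h4 := quad_nonneg hΩn c
    have h5 : quad Qw (act (Bmat f qw q)ᵀ c) = 0 := by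
      nlinarith [mul_nonneg hlam.le h3, mul_nonneg hkap.le h4]
    have h6 : quad (Ωn q Q) c = 0 := by
      nlinarith [mul_nonneg hlam.le h3, mul_nonneg hkap.le h4]
    refine (inner_drift_sub_le hQw hΩn hn hp hw c).trans ?_
    simp [supp, h5, h6]
  intro c hc p hp w hw
  refine le_antisymm (key c hc p hp w hw) ?_
  have := key (-c) (by simp [hc]) p hp w hw
  rw [inner_neg_left] at this
  linarith

end Inequality

/-! ### First order conditions implied by an admissible contracting gain -/

section Consequences

variable {f : Vec nx → Vec nw → Vec nx} {G : Vec nx → Mat nx nu} {W : Set (Vec nw)}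
  {qu : Vec nu} {Qu : Mat nu nu} {q v : Vec nx} {Q A Q' : Mat nx nx} {ubar : Vec nu}
  {K : Mat nu nx}

/-- For `supp Q z < 1` the control is between `ubar` and the boundary case; the homogeneous form of
`AdmissibleGain` combines with `ubar ∈ E(qu, Qu)` without dividing by `supp Q z`. -/
lemma AdmissibleGain.add_mem_ellipsoid (hK : AdmissibleGain qu Qu Q ubar K)
    (hQu : Qu.PosSemidef) (hubar : ubar ∈ ellipsoid qu Qu) {z : Vec nx} (hz : supp Q z ≤ 1) :
    ubar + act K z ∈ ellipsoid qu Qu := by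
  refine mem_ellipsoid_of_forall_inner_le hQu fun e => ?_
  rw [add_sub_right_comm, inner_add_right]
  have h1 := hK z e
  have h2 := inner_sub_le_supp hQu hubar e
  nlinarith [supp_nonneg Q z]

lemma AdmissibleGain.act_eq_zero (hK : AdmissibleGain qu Qu Q ubar K) {c : Vec nx}
    (hc : act Q c = 0) : act K c = 0 := by
  have := hK c (act K c)
  rw [supp_eq_zero hc, zero_mul, zero_mul, zero_add] at this
  exact real_inner_self_nonpos.1 this

lemma eq_zero_of_forall_mul_le_sq {a C : ℝ} (h : ∀ η : ℝ, η * a ≤ C * η ^ 2) : a = 0 := by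
  have hC : 0 < |C| + 1 := by positivity
  have h1 := h (a / (|C| + 1))
  have h2 : a ^ 2 * (|C| + 1) ≤ C * a ^ 2 := by
    have h3 := mul_le_mul_of_nonneg_right h1 (sq_nonneg (|C| + 1))
    have e1 : a / (|C| + 1) * a * (|C| + 1) ^ 2 = a ^ 2 * (|C| + 1) := by field_simp
    have e2 : C * (a / (|C| + 1)) ^ 2 * (|C| + 1) ^ 2 = C * a ^ 2 := by field_simp
    rwa [e1, e2] at h3
  have h4 : a ^ 2 ≤ 0 := by nlinarith [le_abs_self C, sq_nonneg a]
  exact pow_eq_zero_iff two_ne_zero |>.1 (le_antisymm h4 (sq_nonneg a))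

/-- The closed-loop velocity relative to the center differs from `Q' z` by a vector in the range
of `Q`. -/
lemma ContractingGain.exists_act_eq (hb : ContractingGain f G W q Q A Q' ubar v K)
    (ha : AdmissibleGain qu Qu Q ubar K) (hd : DriftCompatible f G W q Q A ubar v)
    (hQ : Q.PosSemidef) (hsymm : Q'ᵀ = Q') (hQ' : ∀ c, act Q c = 0 → quad Q' c = 0)
    {z : Vec nx} (hz : supp Q z ≤ 1) {w : Vec nw} (hw : w ∈ W) :
    ∃ ζ, act Q ζ =
      drift f G ubar v (q + act Q z) w + act (G (q + act Q z)) (act K z) - act Q' z := by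
  refine exists_act_eq_of_orthogonal_ker hQ fun c hc => ?_
  set p := q + act Q z with hp
  have hpm : p ∈ ellipsoid q Q := (mem_ellipsoid_iff hQ).2 ⟨z, hz, rfl⟩
  have h0 := hd c hc p hpm w hw
  set m := drift f G ubar v p w - act A (p - q) with hm
  have hsplit : drift f G ubar v p w + act (G p) (act K z) - act Q' z =
      m + (act A (act Q z) + act (G p) (act K z) - act Q' z) := by
    rw [hm, hp, add_sub_cancel_left]; abel
  rw [hsplit, inner_add_right, h0, zero_add]
  set α : ℝ := inner ℝ c (act A (act Q z) + act (G p) (act K z) - act Q' z) with hα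
  have hα' : α = inner ℝ c (act A (act Q z)) + inner ℝ c (act (G p) (act K z))
      - inner ℝ c (act Q' z) := by rw [hα, inner_sub_right, inner_add_right]
  have hcomm : inner ℝ z (act Q' c) = inner ℝ c (act Q' z) := by
    rw [inner_act, hsymm, real_inner_comm]
  refine eq_zero_of_forall_mul_le_sq (C := |quad Q' z| + |2 * inner ℝ z (act A (act Q z))
    + 2 * inner ℝ z (act (G p) (act K z))| + |2 * supp Q z * inner ℝ z m|) fun η => ?_
  -- For `c` in the kernel, `supp Q (c + η z) = |η| supp Q z`. Compatibility of the drift removes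
  -- the term of order `|η|`, leaving `2 η α = O(η²)` for both signs of `η`, hence `α = 0`.
  have h := hb (c + η • z) p hpm w hw
  have hs : supp Q (c + η • z) = |η| * supp Q z := by
    rw [← supp_smul]
    simp only [supp, quad, act_add, hc, zero_add, inner_add_left]
    rw [inner_act_comm hQ c, hc, inner_zero_right, zero_add]
  have hq : quad Q' (c + η • z) = 2 * η * inner ℝ c (act Q' z) + η ^ 2 * quad Q' z := by
    have := hQ' c hc
    simp only [quad, act_add, act_smul, inner_add_left, inner_add_right, inner_smul_left,
      inner_smul_right, hcomm, conj_trivial] at this ⊢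
    linarith
  rw [hs, hq] at h
  simp only [act_add, act_smul, hc, ha.act_eq_zero hc, zero_add, inner_add_left, inner_smul_left,
    inner_smul_right, conj_trivial] at h
  rw [← hm, h0, zero_add] at h
  have e1 := mul_le_mul_of_nonneg_left (le_abs_self (quad Q' z)) (sq_nonneg η)
  have e2 := mul_le_mul_of_nonneg_left (neg_abs_le (2 * inner ℝ z (act A (act Q z))
    + 2 * inner ℝ z (act (G p) (act K z)))) (sq_nonneg η)
  have e3 : -(η ^ 2 * |2 * supp Q z * inner ℝ z m|) ≤
      2 * (|η| * supp Q z) * (η * inner ℝ z m) := by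
    have := neg_abs_le ((|η| * η) * (2 * supp Q z * inner ℝ z m))
    rw [abs_mul, abs_mul, abs_abs, abs_mul_abs_self] at this
    linarith
  rw [hα']
  have e4 := mul_nonneg (sq_nonneg η) (abs_nonneg (quad Q' z))
  have e5 := mul_nonneg (sq_nonneg η) (abs_nonneg (2 * inner ℝ z (act A (act Q z))
    + 2 * inner ℝ z (act (G p) (act K z))))
  have e6 := mul_nonneg (sq_nonneg η) (abs_nonneg (2 * supp Q z * inner ℝ z m))
  linarith

/-- With `c = z` and `p = q + Q z`, the two terms containing `A` cancel. -/
lemma ContractingGain.two_mul_inner_le (hb : ContractingGain f G W q Q A Q' ubar v K)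
    (hQ : Q.PosSemidef) {z : Vec nx} (hz : supp Q z = 1) {w : Vec nw} (hw : w ∈ W) :
    2 * inner ℝ z (drift f G ubar v (q + act Q z) w + act (G (q + act Q z)) (act K z)) ≤
      quad Q' z := by
  have h := hb z (q + act Q z) ((mem_ellipsoid_iff hQ).2 ⟨z, hz.le, rfl⟩) w hw
  rw [hz, add_sub_cancel_left, inner_sub_right] at h
  rw [inner_add_right]
  linarith

end Consequences

end Gain

/-! ### Measurable selection -/

section Selection

open Filter Topology

variable {X E : Type*} [NormedAddCommGroup E]

/-- Uniqueness of the element of least norm gives all limits of approximate minimizers the same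
value. -/
lemma exists_unique_min_norm [InnerProductSpace ℝ E] [FiniteDimensional ℝ E] {F : Set E}
    (hF : IsClosed F) (hconv : Convex ℝ F) (hne : F.Nonempty) : ∃ M ∈ F, ∀ e ∈ F, ‖e‖ ≤ ‖M‖ → e = M := by
  obtain ⟨M, hM, hMmin⟩ := exists_norm_eq_iInf_of_complete_convex hne hF.isComplete hconv 0
  have h := (norm_eq_iInf_iff_real_inner_le_zero hconv hM).1 hMmin
  refine ⟨M, hM, fun e he hle => ?_⟩
  have h1 := h e he
  rw [zero_sub, inner_neg_left, inner_sub_right, real_inner_self_eq_norm_sq] at h1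
  have h2 : ‖e - M‖ ^ 2 ≤ 0 := by
    rw [norm_sub_sq_real, real_inner_comm]
    nlinarith [norm_nonneg e, norm_nonneg M]
  have h3 : ‖e - M‖ = 0 := pow_eq_zero_iff two_ne_zero |>.1 (le_antisymm h2 (sq_nonneg _))
  exact sub_eq_zero.1 (norm_eq_zero.1 h3)

/-- The penalty functional of the constraints `h i x e ≤ 0`. -/
def penalty (h : ℕ → X → E → ℝ) (k : ℕ) (x : X) (e : E) : ℝ :=
  k * ∑ i ∈ Finset.range k, max (h i x e) 0 + ‖e‖ ^ 2

lemma penalty_nonneg (h : ℕ → X → E → ℝ) (k : ℕ) (x : X) (e : E) : 0 ≤ penalty h k x e := by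
  have : 0 ≤ ∑ i ∈ Finset.range k, max (h i x e) 0 :=
    Finset.sum_nonneg fun i _ => le_max_right _ _
  unfold penalty
  positivity

lemma norm_sq_le_penalty (h : ℕ → X → E → ℝ) (k : ℕ) (x : X) (e : E) :
    ‖e‖ ^ 2 ≤ penalty h k x e := by
  have : 0 ≤ ∑ i ∈ Finset.range k, max (h i x e) 0 :=
    Finset.sum_nonneg fun i _ => le_max_right _ _
  unfold penalty
  have : 0 ≤ (k : ℝ) * ∑ i ∈ Finset.range k, max (h i x e) 0 := by positivity
  linarith

lemma mul_le_penalty (h : ℕ → X → E → ℝ) {i k : ℕ} (hik : i < k) (x : X) (e : E) :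
    k * h i x e ≤ penalty h k x e := by
  have h1 : max (h i x e) 0 ≤ ∑ i ∈ Finset.range k, max (h i x e) 0 :=
    Finset.single_le_sum (f := fun i => max (h i x e) 0) (fun i _ => le_max_right _ _)
      (Finset.mem_range.2 hik)
  have h2 : (k : ℝ) * h i x e ≤ k * ∑ i ∈ Finset.range k, max (h i x e) 0 :=
    mul_le_mul_of_nonneg_left ((le_max_left _ _).trans h1) (Nat.cast_nonneg k)
  unfold penalty
  nlinarith [sq_nonneg ‖e‖]

/-- Measurable selection from the convex solution sets of countably many inequalities
`h i x e ≤ 0` that are measurable in `x` and continuous in `e`. -/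
theorem exists_measurable_selection [MeasurableSpace X] [InnerProductSpace ℝ E]
    [FiniteDimensional ℝ E] [MeasurableSpace E] [BorelSpace E]
    (h : ℕ → X → E → ℝ) (hm : ∀ i e, Measurable fun x => h i x e)
    (hc : ∀ i x, Continuous (h i x)) (hconv : ∀ x, Convex ℝ {e | ∀ i, h i x e ≤ 0})
    (hne : ∀ x, ∃ e, ∀ i, h i x e ≤ 0) :
    ∃ s : X → E, Measurable s ∧ ∀ x i, h i x (s x) ≤ 0 := by
  classical
  have hclosed : ∀ x, IsClosed {e | ∀ i, h i x e ≤ 0} := fun x => by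
    have : {e | ∀ i, h i x e ≤ 0} = ⋂ i, {e | h i x e ≤ 0} := by ext; simp
    rw [this]
    exact isClosed_iInter fun i => isClosed_le (hc i x) continuous_const
  choose M hM hMuniq using fun x => exists_unique_min_norm (hclosed x) (hconv x) (hne x)
  set d := TopologicalSpace.denseSeq E
  have hJm : ∀ k e, Measurable fun x => penalty h k x e := fun k e => by
    unfold penalty
    exact ((Finset.measurable_sum _ fun i _ =>
      (hm i e).max measurable_const).const_mul _).add_const _
  have hJc : ∀ k x, Continuous (penalty h k x) := fun k x => by
    unfold penalty
    exact (continuous_const.mul (continuous_finsetSum _ fun i _ =>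
      (hc i x).max continuous_const)).add (continuous_norm.pow 2)
  have hbdd : ∀ k x, BddBelow (range fun j => penalty h k x (d j)) := fun k x =>
    ⟨0, by rintro _ ⟨j, rfl⟩; exact penalty_nonneg h k x _⟩
  have hex : ∀ k x, ∃ j, penalty h k x (d j) < (⨅ j, penalty h k x (d j)) + 1 / ((k : ℝ) + 1) :=
    fun k x => exists_lt_of_ciInf_lt (lt_add_of_pos_right _ (by positivity))
  have hinfm : ∀ k, Measurable fun x => ⨅ j, penalty h k x (d j) := fun k =>
    Measurable.iInf fun j => hJm k (d j)
  -- The first point of the dense sequence within `1 / (k + 1)` of the infimum of the penalty; only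
  -- countably many measurable conditions decide which one.
  let s : ℕ → X → E := fun k x => d (Nat.find (hex k x))
  have hsm : ∀ k, Measurable (s k) := fun k =>
    (measurable_from_nat (f := d)).comp (measurable_find (hex k) fun j =>
      measurableSet_lt (hJm k (d j)) ((hinfm k).add_const _))
  have hsJ : ∀ k x, penalty h k x (s k x) ≤ ‖M x‖ ^ 2 + 1 / ((k : ℝ) + 1) := by
    intro k x
    refine (Nat.find_spec (hex k x)).le.trans (add_le_add_left ?_ _)
    have hJM : penalty h k x (M x) = ‖M x‖ ^ 2 := by
      have : ∀ i, max (h i x (M x)) 0 = 0 := fun i => max_eq_right (hM x i)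
      simp [penalty, this]
    rw [← hJM]
    refine le_of_forall_pos_lt_add fun ε hε => ?_
    obtain ⟨j, hj⟩ := (TopologicalSpace.denseRange_denseSeq E).exists_mem_open
      ((hJc k x).isOpen_preimage _ (isOpen_Iio (a := penalty h k x (M x) + ε)))
      ⟨M x, by simp [hε]⟩
    exact (ciInf_le (hbdd k x) j).trans_lt hj
  have hone : ∀ k : ℕ, 1 / ((k : ℝ) + 1) ≤ 1 := fun k => by
    rw [div_le_one (by positivity)]; linarith [Nat.cast_nonneg (α := ℝ) k]
  have htend : ∀ x, Tendsto (fun k => s k x) atTop (𝓝 (M x)) := by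
    intro x
    refine tendsto_of_subseq_tendsto fun ns hns => ?_
    have hball : ∀ k, s k x ∈ Metric.closedBall (0 : E) (‖M x‖ + 1) := fun k => by
      rw [mem_closedBall_zero_iff]
      refine abs_le_of_sq_le_sq' ?_ (by positivity) |>.2
      nlinarith [norm_sq_le_penalty h k x (s k x), hsJ k x, hone k, norm_nonneg (M x)]
    obtain ⟨e, -, ms, hms, hlim⟩ := tendsto_subseq_of_bounded Metric.isBounded_closedBall
      fun k => hball (ns k)
    have hsub : Tendsto (fun k => ns (ms k)) atTop atTop := hns.comp hms.tendsto_atTop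
    have hnat : Tendsto (fun k => ((ns (ms k) : ℕ) : ℝ)) atTop atTop :=
      tendsto_natCast_atTop_atTop.comp hsub
    refine ⟨ms, ?_⟩
    suffices he : e = M x by rw [← he]; exact hlim
    -- A cluster point is feasible because `k * h i` stays bounded by `‖M x‖ ^ 2 + 1` while `k → ∞`,
    -- and its norm is at most that of `M x`.
    refine hMuniq x e (fun i => ?_) ?_
    · have h1 : Tendsto (fun k => h i x (s (ns (ms k)) x)) atTop (𝓝 (h i x e)) :=
        ((hc i x).tendsto e).comp hlim
      have h2 : Tendsto (fun k => (‖M x‖ ^ 2 + 1) / (ns (ms k) : ℝ)) atTop (𝓝 0) :=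
        hnat.const_div_atTop _
      refine le_of_tendsto_of_tendsto h1 h2 ?_
      filter_upwards [hsub.eventually_gt_atTop i] with k hk
      have hpos : (0 : ℝ) < ns (ms k) := by exact_mod_cast (Nat.zero_le i).trans_lt hk
      rw [le_div_iff₀ hpos, mul_comm]
      exact (mul_le_penalty h hk x _).trans ((hsJ _ x).trans (by linarith [hone (ns (ms k))]))
    · have h1 : Tendsto (fun k => ‖s (ns (ms k)) x‖ ^ 2) atTop (𝓝 (‖e‖ ^ 2)) := (hlim.norm.pow 2)
      have h2 : Tendsto (fun k => ‖M x‖ ^ 2 + 1 / (((ns (ms k) : ℕ) : ℝ) + 1)) atTop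
          (𝓝 (‖M x‖ ^ 2 + 0)) :=
        tendsto_const_nhds.add ((tendsto_one_div_add_atTop_nhds_zero_nat (𝕜 := ℝ)).comp hsub)
      rw [add_zero] at h2
      exact le_of_sq_le_sq (le_of_tendsto_of_tendsto' h1 h2 fun k =>
        (norm_sq_le_penalty h _ x _).trans (hsJ _ x)) (norm_nonneg _)
  exact ⟨M, measurable_of_tendsto_metrizable hsm (tendsto_pi_nhds.2 htend), fun x => hM x⟩

end Selection

/-! ### Absolutely continuous and one-sided Lipschitz functions -/

section Analysis

open Filter Topology

lemma absolutelyContinuousOnInterval_comp_of_lipschitzOnWith {X Y : Type*} [PseudoMetricSpace X]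
    [PseudoMetricSpace Y] {f : ℝ → X} {g : X → Y} {s : Set X} {C : NNReal} {a b : ℝ}
    (hg : LipschitzOnWith C g s) (hf : AbsolutelyContinuousOnInterval f a b)
    (hs : ∀ t ∈ uIcc a b, f t ∈ s) :
    AbsolutelyContinuousOnInterval (fun t => g (f t)) a b := by
  rw [absolutelyContinuousOnInterval_iff] at hf ⊢
  intro ε hε
  obtain ⟨δ, hδ, h⟩ := hf (ε / (C + 1)) (by positivity)
  refine ⟨δ, hδ, fun E hE hlt => ?_⟩
  have h1 := h E hE hlt
  rw [lt_div_iff₀ (by positivity)] at h1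
  refine lt_of_le_of_lt ?_ h1
  rw [Finset.sum_mul]
  refine Finset.sum_le_sum fun i hi => ?_
  have hmem := hE.1 i hi
  refine (hg.dist_le_mul _ (hs _ hmem.1) _ (hs _ hmem.2)).trans ?_
  rw [mul_comm]
  gcongr
  linarith

lemma sub_le_of_absolutelyContinuous_of_ae_hasDerivAt_le {φ : ℝ → ℝ} {a b C : ℝ}
    (hab : a ≤ b) (hφ : AbsolutelyContinuousOnInterval φ a b)
    (h : ∀ᵐ t, t ∈ Ioo a b → ∀ d, HasDerivAt φ d t → d ≤ C) : φ b - φ a ≤ C * (b - a) := by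
  rw [← hφ.integral_deriv_eq_sub]
  have h1 : ∫ t in a..b, deriv φ t ≤ ∫ _ in a..b, C := by
    refine intervalIntegral.integral_mono_ae_restrict hab hφ.intervalIntegrable_deriv (by simp) ?_
    rw [← restrict_Ioo_eq_restrict_Icc, EventuallyLE, ae_restrict_iff' measurableSet_Ioo]
    filter_upwards [h, hφ.ae_differentiableAt] with t ht hd hmem
    exact ht hmem _ (hd (uIcc_of_le hab ▸ Ioo_subset_Icc_self hmem)).hasDerivAt
  simpa [mul_comm] using h1

/-- A function that is one-sided Lipschitz from above and whose derivative is nonpositive almost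
everywhere where it exists does not increase. -/
lemma le_of_antitoneOn_sub_of_ae_deriv_nonpos {g : ℝ → ℝ} {a b C : ℝ} (hab : a ≤ b)
    (hanti : AntitoneOn (fun t => g t - C * t) (Icc a b))
    (h : ∀ᵐ t, t ∈ Ioo a b → ∀ d, HasDerivAt g d t → d ≤ 0) : g b ≤ g a := by
  -- `φ` is monotone, so the integral of its derivative is at most its increment; this inequality
  -- points the right way whatever the singular part of `φ` is.
  set φ : ℝ → ℝ := fun t => C * t - g t with hφ
  have hmono : MonotoneOn φ (Icc a b) := fun x hx y hy hxy => by
    have := hanti hx hy hxy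
    simp only [hφ] at this ⊢
    linarith
  have hmono' : MonotoneOn φ (uIcc a b) := by rwa [uIcc_of_le hab]
  have hle : φ a ≤ φ b := hmono (left_mem_Icc.2 hab) (right_mem_Icc.2 hab) hab
  have h1 := hmono'.intervalIntegral_deriv_mem_uIcc
  rw [uIcc_of_le (by linarith)] at h1
  have h2 : ∫ _ in a..b, C ≤ ∫ t in a..b, deriv φ t := by
    refine intervalIntegral.integral_mono_ae_restrict hab (by simp)
      hmono'.intervalIntegrable_deriv ?_
    rw [← restrict_Ioo_eq_restrict_Icc, EventuallyLE, ae_restrict_iff' measurableSet_Ioo]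
    filter_upwards [h, hmono.ae_differentiableWithinAt_of_mem] with t ht hd hmem
    have hd' := (hd (Ioo_subset_Icc_self hmem)).differentiableAt (Icc_mem_nhds hmem.1 hmem.2)
    have hg : HasDerivAt g (C - deriv φ t) t := by
      have := ((hasDerivAt_id t).const_mul C).sub hd'.hasDerivAt
      simp only [mul_one] at this
      refine this.congr_of_eventuallyEq (Eventually.of_forall fun s => ?_)
      simp [hφ]
    linarith [ht hmem _ hg]
  have h3 := h1.2
  simp only [intervalIntegral.integral_const, smul_eq_mul] at h2
  simp only [hφ] at h3
  linarith

/-- A Grönwall inequality for nonnegative functions that are one-sided Lipschitz from above. -/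
lemma eq_zero_of_antitoneOn_sub_of_ae_deriv_le {D : ℝ → ℝ} {a b C L : ℝ} (hab : a ≤ b)
    (hL : 0 ≤ L) (hC : 0 ≤ C) (hD : ∀ t, 0 ≤ D t)
    (hanti : ∀ t ∈ Icc a b, ∀ t' ∈ Icc a b, t ≤ t' → D t' ≤ D t + C * (t' - t))
    (h : ∀ᵐ t, t ∈ Ioo a b → ∀ d, HasDerivAt D d t → d ≤ L * D t) (ha : D a = 0) : D b = 0 := by
  have key : Real.exp (-L * b) * D b ≤ Real.exp (-L * a) * D a := by
    refine le_of_antitoneOn_sub_of_ae_deriv_nonpos (g := fun t => Real.exp (-L * t) * D t)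
      (C := Real.exp (-L * a) * C) hab ?_ ?_
    · intro t ht t' ht' htt'
      have h1 : Real.exp (-L * t') ≤ Real.exp (-L * t) := Real.exp_le_exp.2 (by nlinarith)
      have h2 : Real.exp (-L * t') ≤ Real.exp (-L * a) := Real.exp_le_exp.2 (by nlinarith [ht'.1])
      have h3 := mul_le_mul_of_nonneg_left (hanti t ht t' ht' htt') (Real.exp_pos (-L * t')).le
      have h4 := mul_le_mul_of_nonneg_right h1 (hD t)
      have h5 := mul_le_mul_of_nonneg_right h2 (mul_nonneg hC (sub_nonneg.2 htt'))
      simp only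
      linarith
    · filter_upwards [h] with t ht hmem d hd
      have he : HasDerivAt (fun t => Real.exp (L * t)) (Real.exp (L * t) * L) t := by
        simpa using ((hasDerivAt_id t).const_mul L).exp
      -- Only the product is known to be differentiable here, so `D` is recovered as `exp (L t)`
      -- times it.
      have hDd : HasDerivAt D (Real.exp (L * t) * L * (Real.exp (-L * t) * D t)
          + Real.exp (L * t) * d) t := by
        refine (he.mul hd).congr_of_eventuallyEq (Eventually.of_forall fun s => ?_)
        simp [← mul_assoc, ← Real.exp_add]
      have h1 := ht hmem _ hDd
      have h2 : Real.exp (L * t) * L * (Real.exp (-L * t) * D t) = L * D t := by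
        have : Real.exp (L * t) * Real.exp (-L * t) = 1 := by rw [← Real.exp_add]; simp
        linear_combination L * D t * this
      rw [h2] at h1
      by_contra hpos
      push Not at hpos
      linarith [mul_pos (Real.exp_pos (L * t)) hpos]
  rw [ha, mul_zero] at key
  exact le_antisymm (nonpos_of_mul_nonpos_right key (Real.exp_pos _)) (hD b)

/-- If `D` is bounded by the norm of a curve `g`, with equality at `t`, then the derivative
of `D` at `t` is at most the right speed of `g`. -/
lemma deriv_le_norm_of_le_norm {E : Type*} [NormedAddCommGroup E] [NormedSpace ℝ E] {D : ℝ → ℝ}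
    {g : ℝ → E} {t d : ℝ} {g' : E} (hD : HasDerivAt D d t) (hg : HasDerivWithinAt g g' (Ioi t) t)
    (heq : D t = ‖g t‖) (hle : ∀ᶠ s in 𝓝[>] t, D s ≤ ‖g s‖) : d ≤ ‖g'‖ := by
  have h1 := (hasDerivWithinAt_iff_tendsto_slope' (by simp)).1 (hD.hasDerivWithinAt (s := Ioi t))
  have h2 := ((hasDerivWithinAt_iff_tendsto_slope' (by simp)).1 hg).norm
  refine le_of_tendsto_of_tendsto h1 h2 ?_
  filter_upwards [hle, self_mem_nhdsWithin] with s hs hts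
  have hpos : 0 < s - t := sub_pos.2 hts
  rw [slope_def_field, slope_def_module, norm_smul, norm_inv, Real.norm_of_nonneg hpos.le,
    div_eq_inv_mul]
  refine mul_le_mul_of_nonneg_left ?_ (by positivity)
  rw [heq]
  linarith [norm_sub_norm_le (g s) (g t)]

/-- The right derivative of `max 1 ρ` vanishes if `ρ < 1`, or `ρ = 1` and `ρ' ≤ 0`. -/
lemma hasDerivWithinAt_max_one {ρ : ℝ → ℝ} {t ρ' : ℝ} (hρ : HasDerivAt ρ ρ' t) (hle : ρ t ≤ 1)
    (h : ρ t = 1 → ρ' ≤ 0) : HasDerivWithinAt (fun s => max 1 (ρ s)) 0 (Ioi t) t := by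
  rcases hle.lt_or_eq with hlt | heq
  · have : (fun s => max 1 (ρ s)) =ᶠ[𝓝 t] fun _ => 1 := by
      filter_upwards [hρ.continuousAt.eventually_lt continuousAt_const hlt] with s hs
      exact max_eq_left hs.le
    exact ((hasDerivAt_const t (1 : ℝ)).congr_of_eventuallyEq this).hasDerivWithinAt
  · have h1 := (hasDerivWithinAt_iff_tendsto_slope' (by simp)).1 (hρ.hasDerivWithinAt (s := Ioi t))
    rw [hasDerivWithinAt_iff_tendsto_slope' (by simp)]
    have h2 : Tendsto (fun s => max 0 (slope ρ t s)) (𝓝[>] t) (𝓝 (max 0 ρ')) :=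
      tendsto_const_nhds.max h1
    rw [max_eq_left (h heq)] at h2
    refine h2.congr' ?_
    filter_upwards [self_mem_nhdsWithin] with s hs
    have hpos : 0 < s - t := sub_pos.2 hs
    rw [slope_def_field, slope_def_field, heq, max_self]
    rcases le_total 1 (ρ s) with h3 | h3
    · rw [max_eq_right h3, max_eq_right (div_nonneg (sub_nonneg.2 h3) hpos.le)]
    · rw [max_eq_left h3, max_eq_left (div_nonpos_of_nonpos_of_nonneg (sub_nonpos.2 h3) hpos.le),
        sub_self, zero_div]

end Analysis

/-! ### Curves in a moving ellipsoid -/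

section Curves

open Filter Topology

variable {m n : ℕ}

lemma hasDerivAt_vec {φ : ℝ → Vec n} {φ' : Vec n} {t : ℝ}
    (h : ∀ i, HasDerivAt (fun s => φ s i) (φ' i) t) : HasDerivAt φ φ' t :=
  (PiLp.continuousLinearEquiv 2 ℝ fun _ : Fin n => ℝ).symm.hasFDerivAt.comp_hasDerivAt t
    (hasDerivAt_pi.2 h : HasDerivAt (fun s => (φ s).ofLp) φ'.ofLp t)

lemma coord_hasDerivAt {φ : ℝ → Vec n} {φ' : Vec n} {t : ℝ} (h : HasDerivAt φ φ' t) (i : Fin n) :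
    HasDerivAt (fun s => φ s i) (φ' i) t :=
  (EuclideanSpace.proj (𝕜 := ℝ) i).hasFDerivAt.comp_hasDerivAt t h

/-- Entrywise differentiability of a matrix-valued function. -/
def HasMatDerivAt (Q : ℝ → Mat m n) (Q' : Mat m n) (t : ℝ) : Prop :=
  ∀ i j, HasDerivAt (fun s => Q s i j) (Q' i j) t

lemma HasMatDerivAt.act {Q : ℝ → Mat m n} {Q' : Mat m n} {z : ℝ → Vec n} {z' : Vec n} {t : ℝ}
    (hQ : HasMatDerivAt Q Q' t) (hz : HasDerivAt z z' t) :
    HasDerivAt (fun s => act (Q s) (z s)) (act Q' (z t) + act (Q t) z') t := by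
  refine hasDerivAt_vec fun i => ?_
  simp only [act_apply, PiLp.add_apply, ← Finset.sum_add_distrib]
  exact HasDerivAt.fun_sum fun j _ => (hQ i j).mul (coord_hasDerivAt hz j)

lemma HasMatDerivAt.quad {Q : ℝ → Mat n n} {Q' : Mat n n} {t : ℝ} (hQ : HasMatDerivAt Q Q' t)
    (c : Vec n) : HasDerivAt (fun s => quad (Q s) c) (quad Q' c) t := by
  have := (hasDerivAt_const t c).inner ℝ (hQ.act (hasDerivAt_const t c))
  simpa [EllTube.quad] using this

variable {Q : ℝ → Mat n n} {Q' : Mat n n} {t : ℝ}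

lemma HasMatDerivAt.transpose_eq (hQ : HasMatDerivAt Q Q' t)
    (hpsd : ∀ᶠ s in 𝓝 t, (Q s).PosSemidef) : Q'ᵀ = Q' := by
  ext i j
  refine (hQ j i).unique ((hQ i j).congr_of_eventuallyEq ?_)
  filter_upwards [hpsd] with s hs
  exact congrFun₂ (EllTube.transpose_eq hs) i j

/-- The function `cᵀ Q(s) c` is nonnegative near `t` and vanishes at `t`. The neighborhood must be
two-sided, which restricts its use to interior times. -/
lemma HasMatDerivAt.quad_eq_zero (hQ : HasMatDerivAt Q Q' t)
    (hpsd : ∀ᶠ s in 𝓝 t, (Q s).PosSemidef) {c : Vec n} (hc : EllTube.act (Q t) c = 0) :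
    EllTube.quad Q' c = 0 := by
  refine IsLocalMin.hasDerivAt_eq_zero (f := fun s => EllTube.quad (Q s) c) ?_ (hQ.quad c)
  filter_upwards [hpsd] with s hs
  have : EllTube.quad (Q t) c = 0 := by simp [EllTube.quad, hc]
  rw [this]
  exact quad_nonneg hs c

/-- Through a point `q + Q z` of a moving ellipsoid there is a curve in the ellipsoid with any
velocity satisfying the first order conditions. -/
lemma exists_curve_mem_ellipsoid {q : ℝ → Vec n} {v z T ζ : Vec n} (hq : HasDerivAt q v t)
    (hQ : HasMatDerivAt Q Q' t) (hpsd : ∀ᶠ s in 𝓝 t, (Q s).PosSemidef) (hz : supp (Q t) z ≤ 1)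
    (hζ : act (Q t) ζ = T - act Q' z) (hT : supp (Q t) z = 1 → 2 * inner ℝ z T ≤ quad Q' z) :
    ∃ y : ℝ → Vec n, HasDerivWithinAt y (v + T) (Ioi t) t ∧ y t = q t + act (Q t) z ∧
      ∀ᶠ s in 𝓝[>] t, y s ∈ ellipsoid (q s) (Q s) := by
  have hpsdt : (Q t).PosSemidef := hpsd.self_of_nhds
  -- The slope `ζ` is chosen so that `Q Z` has derivative `Q' z + Q ζ = T`.
  set Z : ℝ → Vec n := fun s => z + (s - t) • ζ with hZ
  have hZt : Z t = z := by simp [hZ]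
  have hZd : HasDerivAt Z ζ t := by
    have := (((hasDerivAt_id t).sub_const t).smul_const ζ).const_add z
    simpa [hZ] using this
  have hQZ : HasDerivAt (fun s => act (Q s) (Z s)) T t := by
    have := hQ.act hZd
    rwa [hZt, hζ, add_sub_cancel] at this
  set ρ : ℝ → ℝ := fun s => quad (Q s) (Z s) with hρ
  have hρd : HasDerivAt ρ (2 * inner ℝ z T - quad Q' z) t := by
    have := hZd.inner ℝ hQZ
    have e : inner ℝ (Z t) T + inner ℝ ζ (act (Q t) (Z t)) = 2 * inner ℝ z T - quad Q' z := by
      rw [hZt, inner_act_comm hpsdt, hζ, inner_sub_right, quad]; ring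
    rwa [e] at this
  have hρt : ρ t = supp (Q t) z ^ 2 := by rw [supp_sq hpsdt, hρ]; simp only [hZt]
  have hmax := hasDerivWithinAt_max_one hρd (by rw [hρt]; nlinarith [supp_nonneg (Q t) z])
    (fun h => by
      have : supp (Q t) z = 1 := by
        rw [hρt] at h
        nlinarith [supp_nonneg (Q t) z]
      linarith [hT this])
  have hmaxt : max 1 (ρ t) = 1 := max_eq_left (by rw [hρt]; nlinarith [supp_nonneg (Q t) z])
  -- Dividing by `max 1 ρ` rather than by its root still lands in the ellipsoid, since `√ρ ≤ max 1
  -- ρ`. Its right derivative at `t` is zero, so the velocity is unchanged.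
  refine ⟨fun s => q s + (max 1 (ρ s))⁻¹ • act (Q s) (Z s), ?_, ?_, ?_⟩
  · have h1 := (hmax.inv (by rw [hmaxt]; exact one_ne_zero)).smul
      (hQZ.hasDerivWithinAt (s := Ioi t))
    refine (hq.hasDerivWithinAt.add h1).congr_deriv ?_
    simp [hmaxt]
  · simp [hmaxt, hZt]
  · filter_upwards [hpsd.filter_mono nhdsWithin_le_nhds] with s hs
    refine (mem_ellipsoid_iff hs).2 ⟨(max 1 (ρ s))⁻¹ • Z s, ?_, by rw [act_smul]⟩
    have hpos : 0 < max 1 (ρ s) := lt_of_lt_of_le one_pos (le_max_left _ _)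
    rw [supp_smul, abs_of_pos (inv_pos.2 hpos), inv_mul_le_iff₀ hpos, mul_one]
    rw [supp, Real.sqrt_le_left hpos.le]
    nlinarith [le_max_left 1 (ρ s), le_max_right 1 (ρ s)]

end Curves

/-! ### Distance to an ellipsoid -/

section Distance

variable {n : ℕ} {Q : Mat n n} {q x : Vec n}

lemma infDist_ellipsoid_eq {p : Vec n} (hp : p ∈ ellipsoid q Q)
    (hmin : ∀ y ∈ ellipsoid q Q, ‖x - p‖ ≤ ‖x - y‖) :
    Metric.infDist x (ellipsoid q Q) = ‖x - p‖ := by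
  refine le_antisymm ?_ ?_
  · rw [← dist_eq_norm]; exact Metric.infDist_le_dist_of_mem hp
  · exact (Metric.le_infDist ⟨p, hp⟩).2 fun y hy => by rw [dist_eq_norm]; exact hmin y hy

/-- The normalized outer normal at the nearest point works; when `x` is in the ellipsoid it is `0`,
as `0⁻¹ = 0`. With the converse bound below, the distance is a maximum over `c` of functions that
can be compared at different times for one fixed `c`. -/
lemma exists_infDist_ellipsoid_le (hQ : Q.PosSemidef) :
    ∃ c : Vec n, ‖c‖ ≤ 1 ∧
      Metric.infDist x (ellipsoid q Q) ≤ inner ℝ c (x - q) - supp Q c := by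
  obtain ⟨p, hp, hmin⟩ := exists_nearest_ellipsoid q x Q
  have h := supp_le_of_nearest hQ hp hmin
  rw [infDist_ellipsoid_eq hp hmin]
  refine ⟨‖x - p‖⁻¹ • (x - p), ?_, ?_⟩
  · rw [norm_smul, norm_inv, norm_norm]
    exact inv_mul_le_one
  · rw [supp_smul, abs_of_nonneg (by positivity), inner_smul_left]
    have e : inner ℝ (x - p) (x - q) = ‖x - p‖ ^ 2 + inner ℝ (x - p) (p - q) := by
      rw [← real_inner_self_eq_norm_sq, ← inner_add_right, sub_add_sub_cancel]
    rw [e, conj_trivial, ← mul_sub]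
    rcases eq_or_ne ‖x - p‖ 0 with h0 | h0
    · simp [h0]
    · have : ‖x - p‖⁻¹ * ‖x - p‖ ^ 2 = ‖x - p‖ := by field_simp
      have h2 : 0 ≤ ‖x - p‖⁻¹ * (inner ℝ (x - p) (p - q) - supp Q (x - p)) :=
        mul_nonneg (by positivity) (sub_nonneg.2 h)
      linarith [mul_sub (‖x - p‖⁻¹) (inner ℝ (x - p) (p - q)) (supp Q (x - p)),
        mul_sub (‖x - p‖⁻¹) (‖x - p‖ ^ 2 + inner ℝ (x - p) (p - q)) (supp Q (x - p)),
        mul_add (‖x - p‖⁻¹) (‖x - p‖ ^ 2) (inner ℝ (x - p) (p - q))]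

lemma inner_sub_supp_le_infDist (hQ : Q.PosSemidef) {c : Vec n} (hc : ‖c‖ ≤ 1) :
    inner ℝ c (x - q) - supp Q c ≤ Metric.infDist x (ellipsoid q Q) := by
  refine (Metric.le_infDist ⟨q, center_mem_ellipsoid q Q⟩).2 fun y hy => ?_
  have h1 := inner_sub_le_supp hQ hy c
  have h2 : inner ℝ c (x - y) ≤ ‖x - y‖ :=
    (real_inner_le_norm _ _).trans (mul_le_of_le_one_left (norm_nonneg _) hc)
  have e : inner ℝ c (x - q) = inner ℝ c (x - y) + inner ℝ c (y - q) := by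
    rw [← inner_add_right, sub_add_sub_cancel]
  rw [dist_eq_norm]
  linarith

end Distance

/-! ### Bounds for the right-hand side -/

section Bounds

variable {nx nu nw : ℕ} {f : Vec nx → Vec nw → Vec nx} {G : Vec nx → Mat nx nu}

lemma contDiff_rhs (hf : ContDiff ℝ 2 fun z : Vec nx × Vec nw => f z.1 z.2)
    (hG : ∀ i j, ContDiff ℝ 2 fun x => G x i j) :
    ContDiff ℝ 1 fun z : Vec nx × Vec nu × Vec nw => rhs f G z.1 z.2.1 z.2.2 := by
  have h12 : (1 : WithTop ℕ∞) ≤ 2 := by norm_num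
  have h1 : ContDiff ℝ 1 fun z : Vec nx × Vec nu × Vec nw => f z.1 z.2.2 :=
    (hf.of_le h12).comp (contDiff_fst.prodMk contDiff_snd.snd)
  have h2 : ContDiff ℝ 1 fun z : Vec nx × Vec nu × Vec nw => act (G z.1) z.2.1 := by
    refine contDiff_euclidean.2 fun i => ?_
    simp only [act_apply]
    refine ContDiff.sum fun j _ => (((hG i j).of_le h12).comp contDiff_fst).mul ?_
    exact (contDiff_euclidean.1 contDiff_id j).comp contDiff_snd.fst
  exact h1.add h2

lemma exists_bound_rhs (hf : ContDiff ℝ 2 fun z : Vec nx × Vec nw => f z.1 z.2)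
    (hG : ∀ i j, ContDiff ℝ 2 fun x => G x i j) (r : ℝ) {U : Set (Vec nu)} (hU : IsCompact U)
    {W : Set (Vec nw)} (hW : IsCompact W) :
    ∃ B L : ℝ, 0 ≤ B ∧ 0 ≤ L ∧ ∀ u ∈ U, ∀ w ∈ W, ∀ x : Vec nx, ‖x‖ ≤ r →
      ‖rhs f G x u w‖ ≤ B ∧
      ∀ y : Vec nx, ‖y‖ ≤ r → ‖rhs f G x u w - rhs f G y u w‖ ≤ L * ‖x - y‖ := by
  have hc := contDiff_rhs hf hG
  have hK : IsCompact (Metric.closedBall (0 : Vec nx) r ×ˢ U ×ˢ W) :=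
    (isCompact_closedBall _ _).prod (hU.prod hW)
  obtain ⟨B, hB⟩ := hK.exists_bound_of_continuousOn hc.continuous.continuousOn
  obtain ⟨L, hL⟩ := (hc.locallyLipschitz.locallyLipschitzOn).exists_lipschitzOnWith_of_compact hK
  refine ⟨max B 0, L, le_max_right _ _, L.2, fun u hu w hw x hx => ⟨?_, fun y hy => ?_⟩⟩
  · exact (hB (x, u, w) ⟨by simpa using hx, hu, hw⟩).trans (le_max_left _ _)
  · have := hL.dist_le_mul (x, u, w) ⟨by simpa using hx, hu, hw⟩ (y, u, w)
      ⟨by simpa using hy, hu, hw⟩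
    simpa [dist_eq_norm, Prod.norm_def] using this

lemma exists_supp_le {n : ℕ} {Q : ℝ → Mat n n} {t₁ t₂ : ℝ}
    (hQ : ∀ i j, ContinuousOn (fun t => Q t i j) (Icc t₁ t₂)) :
    ∃ C : ℝ, ∀ t ∈ Icc t₁ t₂, ∀ c, supp (Q t) c ≤ C * ‖c‖ := by
  choose C hC using fun i j => isCompact_Icc.exists_bound_of_continuousOn (hQ i j)
  refine ⟨√(∑ i, ∑ j, C i j), fun t ht c => ?_⟩
  rw [supp, ← Real.sqrt_sq (norm_nonneg c), ← Real.sqrt_mul' _ (sq_nonneg _)]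
  refine Real.sqrt_le_sqrt ?_
  rw [quad_eq_sum, Finset.sum_mul]
  refine Finset.sum_le_sum fun i _ => ?_
  rw [Finset.sum_mul]
  refine Finset.sum_le_sum fun j _ => ?_
  refine (le_abs_self _).trans ?_
  rw [abs_mul, abs_mul, sq]
  have h1 := hC i j t ht
  have hi : |c i| ≤ ‖c‖ := PiLp.norm_apply_le c i
  have hj : |c j| ≤ ‖c‖ := PiLp.norm_apply_le c j
  rw [Real.norm_eq_abs] at h1
  exact mul_le_mul h1 (mul_le_mul hi hj (abs_nonneg _) (norm_nonneg _)) (by positivity)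
    ((abs_nonneg _).trans h1)

lemma norm_sub_le_of_mem_ellipsoid {n : ℕ} {Q : Mat n n} (hQ : Q.PosSemidef) {q p : Vec n} {C : ℝ}
    (hC : ∀ c, supp Q c ≤ C * ‖c‖) (hp : p ∈ ellipsoid q Q) : ‖p - q‖ ≤ max C 0 := by
  have h1 := (inner_sub_le_supp hQ hp (p - q)).trans (hC (p - q))
  rw [real_inner_self_eq_norm_sq] at h1
  rcases eq_or_lt_of_le (norm_nonneg (p - q)) with h0 | h0
  · rw [← h0]; exact le_max_right _ _
  · exact (le_of_mul_le_mul_right (by rwa [sq] at h1) h0).trans (le_max_left _ _)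

end Bounds

/-! ### Invariance of the tube under the feedback -/

section Invariance

open Filter Topology

variable {nx nu nw : ℕ} {f : Vec nx → Vec nw → Vec nx} {G : Vec nx → Mat nx nu}
  {qw : Vec nw} {Qw : Mat nw nw} {qu : Vec nu} {Qu : Mat nu nu}

lemma drift_add_act (ubar ν : Vec nu) (v p : Vec nx) (w : Vec nw) :
    drift f G ubar v p w + act (G p) ν = rhs f G p (ubar + ν) w - v := by
  simp only [drift, rhs, act_add]
  abel

/-- The shape velocity is bounded from below in terms of the closed-loop velocity. -/
lemma ContractingGain.neg_le_quad {W : Set (Vec nw)} {q v : Vec nx} {Q A Q' : Mat nx nx}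
    {ubar : Vec nu} {K : Mat nu nx} {B : ℝ} (hb : ContractingGain f G W q Q A Q' ubar v K)
    (ha : AdmissibleGain qu Qu Q ubar K) (hQu : Qu.PosSemidef) (hubar : ubar ∈ ellipsoid qu Qu)
    (hQ : Q.PosSemidef) (hQ' : ∀ c, act Q c = 0 → quad Q' c = 0) {w : Vec nw} (hw : w ∈ W)
    (hB : ∀ p ∈ ellipsoid q Q, ∀ u ∈ ellipsoid qu Qu, ‖rhs f G p u w - v‖ ≤ B) (c : Vec nx) :
    -(2 * B * supp Q c * ‖c‖) ≤ quad Q' c := by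
  rcases (supp_nonneg Q c).eq_or_lt with h0 | hpos
  · rw [hQ' c (act_eq_zero_of_supp hQ h0.symm), ← h0]
    simp
  -- Both sides are homogeneous of degree two, so `c` is normalized to `supp Q z = 1`, where the
  -- first order condition at the boundary applies.
  · set z := (supp Q c)⁻¹ • c with hz
    have hsz : supp Q z = 1 := by
      rw [hz, supp_smul, abs_of_pos (inv_pos.2 hpos), inv_mul_cancel₀ hpos.ne']
    have h1 := hb.two_mul_inner_le hQ hsz hw
    have hB' := hB (q + act Q z) ((mem_ellipsoid_iff hQ).2 ⟨z, hsz.le, rfl⟩) _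
      (ha.add_mem_ellipsoid hQu hubar hsz.le)
    rw [drift_add_act] at h1
    have h2 := neg_le_of_abs_le (abs_real_inner_le_norm z
      (rhs f G (q + act Q z) (ubar + act K z) w - v))
    have h3 := mul_le_mul_of_nonneg_left hB' (norm_nonneg z)
    have h4 : quad Q' z = (supp Q c)⁻¹ ^ 2 * quad Q' c := by rw [hz, quad_smul]
    have h5 : ‖z‖ = (supp Q c)⁻¹ * ‖c‖ := by
      rw [hz, norm_smul, norm_inv, Real.norm_of_nonneg hpos.le]
    have h6 : -(2 * ((supp Q c)⁻¹ * ‖c‖ * B)) ≤ (supp Q c)⁻¹ ^ 2 * quad Q' c := by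
      rw [← h4, ← h5]; linarith
    have h7 := mul_le_mul_of_nonneg_left h6 (sq_nonneg (supp Q c))
    have e1 : supp Q c ^ 2 * ((supp Q c)⁻¹ ^ 2 * quad Q' c) = quad Q' c := by field_simp
    have e2 : supp Q c ^ 2 * -(2 * ((supp Q c)⁻¹ * ‖c‖ * B)) = -(2 * B * supp Q c * ‖c‖) := by
      field_simp
    rwa [e1, e2] at h7

lemma absolutelyContinuousOnInterval_inner {n : ℕ} {x : ℝ → Vec n} {a b : ℝ}
    (hx : AbsolutelyContinuousOnInterval x a b) (c : Vec n) :
    AbsolutelyContinuousOnInterval (fun t => inner ℝ c (x t)) a b :=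
  absolutelyContinuousOnInterval_comp_of_lipschitzOnWith
    (innerSL ℝ c).lipschitz.lipschitzOnWith hx fun _ _ => mem_univ _

lemma absolutelyContinuousOnInterval_sum {ι : Type*} (s : Finset ι) {φ : ι → ℝ → ℝ} {a b : ℝ}
    (h : ∀ i ∈ s, AbsolutelyContinuousOnInterval (φ i) a b) :
    AbsolutelyContinuousOnInterval (fun t => ∑ i ∈ s, φ i t) a b := by
  classical
  induction s using Finset.induction_on with
  | empty =>
    simp only [Finset.sum_empty]
    exact ((LipschitzWith.const (0 : ℝ)).lipschitzOnWith
      (s := uIcc a b)).absolutelyContinuousOnInterval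
  | insert i s hi ih =>
    simp only [Finset.sum_insert hi]
    exact (h i (by simp)).add (ih fun j hj => h j (by simp [hj]))

lemma absolutelyContinuousOnInterval_quad {n : ℕ} {Q : ℝ → Mat n n} {a b : ℝ}
    (hQ : ∀ i j, AbsolutelyContinuousOnInterval (fun t => Q t i j) a b) (c : Vec n) :
    AbsolutelyContinuousOnInterval (fun t => quad (Q t) c) a b := by
  simp only [quad_eq_sum]
  refine absolutelyContinuousOnInterval_sum _ fun i _ =>
    absolutelyContinuousOnInterval_sum _ fun j _ => ?_
  simpa [mul_comm] using (hQ i j).const_mul (c i * c j)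

lemma ae_hasMatDerivAt {m n : ℕ} {Q : ℝ → Mat m n} {a b : ℝ}
    (hQ : ∀ i j, AbsolutelyContinuousOnInterval (fun t => Q t i j) a b) (hab : a ≤ b) :
    ∀ᵐ t, t ∈ Icc a b → HasMatDerivAt Q (matDeriv Q t) t := by
  have : ∀ᵐ t, ∀ i j, t ∈ uIcc a b → DifferentiableAt ℝ (fun t => Q t i j) t :=
    ae_all_iff.2 fun i => ae_all_iff.2 fun j => (hQ i j).ae_differentiableAt
  filter_upwards [this] with t ht hmem i j
  exact (ht i j (by rwa [uIcc_of_le hab])).hasDerivAt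

/-- The shift by `ε` avoids the infinite slope of the root at zero, so that composition preserves
absolute continuity. -/
lemma lipschitzOnWith_sqrt_add {ε : ℝ} (hε : 0 < ε) :
    LipschitzOnWith (Real.toNNReal (√ε)⁻¹) (fun y => √(y + ε)) (Ici 0) := by
  refine LipschitzOnWith.of_dist_le_mul fun y hy y' hy' => ?_
  rw [Real.coe_toNNReal _ (by positivity), Real.dist_eq, Real.dist_eq]
  have hpos : 0 < √ε := Real.sqrt_pos.2 hε
  have hy0 : (0 : ℝ) ≤ y := hy
  have hy0' : (0 : ℝ) ≤ y' := hy'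
  have h1 : √ε ≤ √(y + ε) := Real.sqrt_le_sqrt (by linarith)
  have h2 : (√(y + ε) - √(y' + ε)) * (√(y + ε) + √(y' + ε)) = y - y' := by
    have e1 := Real.sq_sqrt (show 0 ≤ y + ε by linarith)
    have e2 := Real.sq_sqrt (show 0 ≤ y' + ε by linarith)
    linear_combination e1 - e2
  rw [← h2, abs_mul, inv_mul_eq_div, le_div_iff₀ hpos]
  refine mul_le_mul_of_nonneg_left ?_ (abs_nonneg _)
  rw [abs_of_nonneg (by positivity)]
  linarith [Real.sqrt_nonneg (y' + ε)]

/-- If the velocity of `x - q` is bounded and the shape velocity is bounded from below, then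
`cᵀ (x - q) - √(cᵀ Q c)` is one-sided Lipschitz. -/
lemma inner_sub_supp_le_add {x q : ℝ → Vec nx} {Q : ℝ → Mat nx nx} {a b B : ℝ} (hab : a ≤ b)
    (hB : 0 ≤ B)
    (hx : AbsolutelyContinuousOnInterval x a b) (hq : AbsolutelyContinuousOnInterval q a b)
    (hQ : ∀ i j, AbsolutelyContinuousOnInterval (fun t => Q t i j) a b)
    (hpsd : ∀ t ∈ Icc a b, (Q t).PosSemidef) {c : Vec nx} (hc : ‖c‖ ≤ 1)
    (h : ∀ᵐ t, t ∈ Ioo a b → ∃ x' q' Q', HasDerivAt x x' t ∧ HasDerivAt q q' t ∧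
      HasMatDerivAt Q Q' t ∧ ‖x' - q'‖ ≤ B ∧ -(2 * B * supp (Q t) c * ‖c‖) ≤ quad Q' c) :
    inner ℝ c (x b - q b) - supp (Q b) c ≤
      inner ℝ c (x a - q a) - supp (Q a) c + 2 * B * (b - a) := by
  -- The inner product and the regularized root each contribute at most `B` to the derivative,
  -- uniformly in `ε`, so `ε` can be sent to zero.
  have key : ∀ ε > 0, inner ℝ c (x b - q b) - √(quad (Q b) c + ε)
      - (inner ℝ c (x a - q a) - √(quad (Q a) c + ε)) ≤ 2 * B * (b - a) := by
    intro ε hε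
    refine sub_le_of_absolutelyContinuous_of_ae_hasDerivAt_le
      (φ := fun t => inner ℝ c (x t - q t) - √(quad (Q t) c + ε)) hab ?_ ?_
    · have h1 : AbsolutelyContinuousOnInterval (fun t => inner ℝ c (x t - q t)) a b :=
        absolutelyContinuousOnInterval_inner (x := fun t => x t - q t) (hx.sub hq) c
      have h2 : AbsolutelyContinuousOnInterval (fun t => √(quad (Q t) c + ε)) a b := by
        refine absolutelyContinuousOnInterval_comp_of_lipschitzOnWith
          (f := fun t => quad (Q t) c) (g := fun y => √(y + ε)) (lipschitzOnWith_sqrt_add hε)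
          (absolutelyContinuousOnInterval_quad hQ c) fun t ht => ?_
        rw [uIcc_of_le hab] at ht
        exact quad_nonneg (hpsd t ht) c
      exact h1.sub h2
    · filter_upwards [h] with t ht hmem d hd
      obtain ⟨x', q', Q', hx', hq', hQ', hle, hquad⟩ := ht hmem
      have hps := hpsd t (Ioo_subset_Icc_self hmem)
      have hpos : 0 < quad (Q t) c + ε := by linarith [quad_nonneg hps c]
      have h1 : HasDerivAt (fun t => inner ℝ c (x t - q t)) (inner ℝ c (x' - q')) t := by
        simpa using (hasDerivAt_const t c).inner ℝ (hx'.sub hq')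
      have h2 := ((hQ'.quad c).add_const ε).sqrt hpos.ne'
      rw [hd.unique (h1.sub h2)]
      have h3 : inner ℝ c (x' - q') ≤ B :=
        (real_inner_le_norm _ _).trans ((mul_le_of_le_one_left (norm_nonneg _) hc).trans hle)
      have hs : 0 < √(quad (Q t) c + ε) := Real.sqrt_pos.2 hpos
      have h4 : supp (Q t) c ≤ √(quad (Q t) c + ε) := Real.sqrt_le_sqrt (by linarith)
      have h5 : -B ≤ quad Q' c / (2 * √(quad (Q t) c + ε)) := by
        rw [le_div_iff₀ (by positivity)]
        have h6 : supp (Q t) c * ‖c‖ ≤ √(quad (Q t) c + ε) * 1 :=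
          mul_le_mul h4 hc (norm_nonneg _) hs.le
        nlinarith
      linarith
  have hlim : ∀ y : ℝ, Tendsto (fun ε => √(y + ε)) (𝓝[>] 0) (𝓝 √y) := fun y => by
    have : Continuous fun ε => √(y + ε) := by fun_prop
    simpa using (this.tendsto 0).mono_left nhdsWithin_le_nhds
  have := le_of_tendsto ((tendsto_const_nhds.sub (hlim (quad (Q b) c))).sub
    (tendsto_const_nhds.sub (hlim (quad (Q a) c))))
    (eventually_nhdsWithin_of_forall fun ε hε => key ε hε)
  simp only [supp]
  linarith

/-- The tube is invariant under a feedback `ubar + K z`, where `z` parametrizes the nearest point of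
the ellipsoid and `K` is a contracting gain. -/
theorem mem_ellipsoid_of_isClosedLoopSolution
    (hf : ContDiff ℝ 2 fun z : Vec nx × Vec nw => f z.1 z.2)
    (hG : ∀ i j, ContDiff ℝ 2 fun x => G x i j) (hQu : Qu.PosSemidef) {t₁ t₂ : ℝ}
    {q : ℝ → Vec nx} (hq : AbsolutelyContinuousOnInterval q t₁ t₂) {Q : ℝ → Mat nx nx}
    (hQ : ∀ i j, AbsolutelyContinuousOnInterval (fun t => Q t i j) t₁ t₂)
    (hpsd : ∀ t ∈ Icc t₁ t₂, (Q t).PosSemidef) {u ubar : ℝ → Vec nu}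
    (hu : ∀ t ∈ Icc t₁ t₂, u t ∈ ellipsoid qu Qu)
    (hubar : ∀ t ∈ Icc t₁ t₂, ubar t ∈ ellipsoid qu Qu)
    (hode : ∀ᵐ t, t ∈ Icc t₁ t₂ → HasDerivAt q (rhs f G (q t) (u t) qw) t)
    {A : ℝ → Mat nx nx} {K : ℝ → Mat nu nx} {z : ℝ → Vec nx → Vec nx}
    (hz : ∀ t ∈ Icc t₁ t₂, ∀ ξ, supp (Q t) (z t ξ) ≤ 1 ∧
      ∀ y ∈ ellipsoid (q t) (Q t), ‖ξ - (q t + act (Q t) (z t ξ))‖ ≤ ‖ξ - y‖)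
    (hadm : ∀ᵐ t, t ∈ Icc t₁ t₂ → AdmissibleGain qu Qu (Q t) (ubar t) (K t))
    (hcon : ∀ᵐ t, t ∈ Icc t₁ t₂ → ContractingGain f G (ellipsoid qw Qw) (q t) (Q t) (A t)
      (matDeriv Q t) (ubar t) (rhs f G (q t) (u t) qw) (K t))
    (hcomp : ∀ᵐ t, t ∈ Ioo t₁ t₂ → DriftCompatible f G (ellipsoid qw Qw) (q t) (Q t) (A t) (ubar t)
      (rhs f G (q t) (u t) qw))
    {μ : ℝ → Vec nx → Vec nu}
    (hμ : ∀ᵐ t, t ∈ Icc t₁ t₂ → ∀ ξ, μ t ξ = ubar t + act (K t) (z t ξ))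
    {w : ℝ → Vec nw} (hw : ∀ t ∈ Icc t₁ t₂, w t ∈ ellipsoid qw Qw) {s s' : ℝ}
    (hs : s ∈ Icc t₁ t₂) (hs' : s' ∈ Icc t₁ t₂) (hss' : s ≤ s') {x : ℝ → Vec nx}
    (hx : IsClosedLoopSolution f G μ w s s' x) (hxs : x s ∈ ellipsoid (q s) (Q s)) :
    x s' ∈ ellipsoid (q s') (Q s') := by
  have h12 : t₁ ≤ t₂ := hs.1.trans hs.2
  have hsub : Icc s s' ⊆ Icc t₁ t₂ := Icc_subset_Icc hs.1 hs'.2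
  have hsub' : Ioo s s' ⊆ Ioo t₁ t₂ := Ioo_subset_Ioo hs.1 hs'.2
  obtain ⟨hxac, hxd⟩ := hx
  have hqw : qw ∈ ellipsoid qw Qw := center_mem_ellipsoid _ _
  -- uniform bounds
  obtain ⟨C, hC⟩ := exists_supp_le (Q := Q) (t₁ := t₁) (t₂ := t₂) fun i j => by
    simpa [uIcc_of_le h12] using (hQ i j).continuousOn
  obtain ⟨Cq, hCq⟩ := hq.exists_bound
  obtain ⟨Cx, hCx⟩ := hxac.exists_bound
  rw [uIcc_of_le h12] at hCq
  rw [uIcc_of_le hss'] at hCx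
  set r := max Cx (Cq + max C 0) with hr
  have hxr : ∀ t ∈ Icc s s', ‖x t‖ ≤ r := fun t ht => (hCx t ht).trans (le_max_left _ _)
  have hpr : ∀ t ∈ Icc t₁ t₂, ∀ p ∈ ellipsoid (q t) (Q t), ‖p‖ ≤ r := fun t ht p hp => by
    have h1 := norm_sub_le_of_mem_ellipsoid (hpsd t ht) (hC t ht) hp
    have h2 := norm_le_norm_add_norm_sub' p (q t)
    exact le_trans (by linarith [hCq t ht]) (le_max_right _ _)
  obtain ⟨B, L, hB0, hL0, hBL⟩ := exists_bound_rhs hf hG r (isCompact_ellipsoid qu Qu)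
    (isCompact_ellipsoid qw Qw)
  have hvB : ∀ t ∈ Icc t₁ t₂, ‖rhs f G (q t) (u t) qw‖ ≤ B := fun t ht =>
    (hBL (u t) (hu t ht) qw hqw (q t) (hpr t ht _ (center_mem_ellipsoid _ _))).1
  have hQd := ae_hasMatDerivAt hQ h12
  have hnear : ∀ t ∈ Ioo t₁ t₂, ∀ᶠ τ in 𝓝 t, (Q τ).PosSemidef := fun t ht => by
    filter_upwards [Icc_mem_nhds ht.1 ht.2] with τ hτ using hpsd τ hτ
  set D : ℝ → ℝ := fun t => Metric.infDist (x t) (ellipsoid (q t) (Q t)) with hD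
  have hD0 : D s' = 0 := by
    -- The velocity relative to the center is at most `2 * B`, being a difference of two values of
    -- the right-hand side; the outer factor `2` is that of `inner_sub_supp_le_add`.
    refine eq_zero_of_antitoneOn_sub_of_ae_deriv_le (D := D) (C := 2 * (2 * B)) (L := L) hss' hL0
      (by positivity) (fun t => Metric.infDist_nonneg) ?_ ?_ (Metric.infDist_zero_of_mem hxs)
    · intro t ht t' ht' htt'
      -- The direction optimal at the later time `t'` is kept fixed and is only a competitor at `t`.
      obtain ⟨c, hc, hle⟩ := exists_infDist_ellipsoid_le (x := x t') (q := q t')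
        (hpsd t' (hsub ht'))
      refine hle.trans (le_trans ?_ (add_le_add_left
        (inner_sub_supp_le_infDist (hpsd t (hsub ht)) hc) _))
      have hsubt : Icc t t' ⊆ Icc s s' := Icc_subset_Icc ht.1 ht'.2
      have hut : uIcc t t' ⊆ uIcc t₁ t₂ := by
        rw [uIcc_of_le htt', uIcc_of_le h12]; exact hsubt.trans hsub
      have hut' : uIcc t t' ⊆ uIcc s s' := by
        rw [uIcc_of_le htt', uIcc_of_le hss']; exact hsubt
      refine inner_sub_supp_le_add htt' (by positivity) (hxac.mono hut') (hq.mono hut)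
        (fun i j => (hQ i j).mono hut) (fun τ hτ => hpsd τ (hsub (hsubt hτ))) hc ?_
      filter_upwards [hxd, hode, hQd, hadm, hcon, hμ] with τ h1 h2 h3 h4 h5 h6 hmem
      have hτ' := hsubt (Ioo_subset_Icc_self hmem)
      have hτ := hsub hτ'
      have hτo : τ ∈ Ioo t₁ t₂ := hsub' (Ioo_subset_Ioo ht.1 ht'.2 hmem)
      have hQ0 : ∀ c, act (Q τ) c = 0 → quad (matDeriv Q τ) c = 0 := fun c hc =>
        (h3 hτ).quad_eq_zero (hnear τ hτo) hc
      refine ⟨_, _, _, h1 hτ', h2 hτ, h3 hτ, ?_, ?_⟩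
      · rw [h6 hτ]
        have hmu := (h4 hτ).add_mem_ellipsoid hQu (hubar τ hτ) (hz τ hτ (x τ)).1
        have := (hBL _ hmu _ (hw τ hτ) (x τ) (hxr τ hτ')).1
        exact (norm_sub_le _ _).trans (by linarith [hvB τ hτ])
      · refine (h5 hτ).neg_le_quad (h4 hτ) hQu (hubar τ hτ) (hpsd τ hτ) hQ0 (hw τ hτ) ?_ c
        intro p hp u hu
        have := (hBL u hu _ (hw τ hτ) p (hpr τ hτ p hp)).1
        exact (norm_sub_le _ _).trans (by linarith [hvB τ hτ])
    · filter_upwards [hxd, hode, hQd, hadm, hcon, hcomp, hμ] with τ h1 h2 h3 h4 h5 h6 h7 hmem d hd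
      have hτ' := Ioo_subset_Icc_self hmem
      have hτ := hsub hτ'
      have hτo : τ ∈ Ioo t₁ t₂ := hsub' hmem
      have hQ0 : ∀ c, act (Q τ) c = 0 → quad (matDeriv Q τ) c = 0 := fun c hc =>
        (h3 hτ).quad_eq_zero (hnear τ hτo) hc
      obtain ⟨hz1, hzmin⟩ := hz τ hτ (x τ)
      set ζ₀ := z τ (x τ)
      set p := q τ + act (Q τ) ζ₀ with hp
      have hpm : p ∈ ellipsoid (q τ) (Q τ) := (mem_ellipsoid_iff (hpsd τ hτ)).2 ⟨ζ₀, hz1, rfl⟩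
      obtain ⟨ζ, hζ⟩ := (h5 hτ).exists_act_eq (h4 hτ) (h6 hτo) (hpsd τ hτ)
        ((h3 hτ).transpose_eq (hnear τ hτo)) hQ0 hz1 (hw τ hτ)
      obtain ⟨y, hyd, hyt, hymem⟩ := exists_curve_mem_ellipsoid (h2 hτ) (h3 hτ) (hnear τ hτo) hz1 hζ
        (fun h => (h5 hτ).two_mul_inner_le (hpsd τ hτ) h (hw τ hτ))
      -- The comparison curve now has velocity `g(p, u, w)` with the very control applied at `x`, so
      -- the two velocities differ only in the state.
      rw [drift_add_act, add_sub_cancel] at hyd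
      have hgd := ((h1 hτ').hasDerivWithinAt (s := Ioi τ)).sub hyd
      have hle := deriv_le_norm_of_le_norm (g := x - y) hd hgd
        (by rw [hD, Pi.sub_apply, hyt]; exact infDist_ellipsoid_eq hpm hzmin) (by
          filter_upwards [hymem] with τ' hτ''
          rw [Pi.sub_apply, ← dist_eq_norm]
          exact Metric.infDist_le_dist_of_mem hτ'')
      refine hle.trans ?_
      rw [h7 hτ, hD]
      simp only
      rw [infDist_ellipsoid_eq hpm hzmin]
      exact (hBL _ ((h4 hτ).add_mem_ellipsoid hQu (hubar τ hτ) hz1) _ (hw τ hτ) _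
        (hxr τ hτ')).2 p (hpr τ hτ p hpm)
  exact ((isCompact_ellipsoid _ _).isClosed.mem_iff_infDist_zero
    ⟨_, center_mem_ellipsoid _ _⟩).2 hD0

end Invariance

/-! ### Measurability -/

section Measurability

variable {X : Type*} [MeasurableSpace X] {m n : ℕ}

lemma continuous_vec {Y : Type*} [TopologicalSpace Y] {φ : Y → Vec n}
    (h : ∀ i, Continuous fun y => φ y i) : Continuous φ :=
  (PiLp.continuous_toLp 2 fun _ : Fin n => ℝ).comp
    (continuous_pi h : Continuous fun y => (φ y).ofLp)

lemma measurable_vec {φ : X → Vec n} (h : ∀ i, Measurable fun x => φ x i) : Measurable φ :=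
  (PiLp.continuous_toLp 2 fun _ : Fin n => ℝ).measurable.comp
    (measurable_pi_lambda (fun x => (φ x).ofLp) h)

lemma measurable_coord {φ : X → Vec n} (h : Measurable φ) (i : Fin n) :
    Measurable fun x => φ x i :=
  (EuclideanSpace.proj (𝕜 := ℝ) i).continuous.measurable.comp h

lemma measurable_act {M : X → Mat m n} (hM : ∀ i j, Measurable fun x => M x i j) {z : X → Vec n}
    (hz : Measurable z) : Measurable fun x => act (M x) (z x) := by
  refine measurable_vec fun i => ?_
  simp only [act_apply]
  exact Finset.measurable_sum _ fun j _ => (hM i j).mul (measurable_coord hz j)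

lemma measurable_quad {M : X → Mat n n} (hM : ∀ i j, Measurable fun x => M x i j) {z : X → Vec n}
    (hz : Measurable z) : Measurable fun x => quad (M x) (z x) :=
  hz.inner (measurable_act hM hz)

lemma measurable_supp {M : X → Mat n n} (hM : ∀ i j, Measurable fun x => M x i j) {z : X → Vec n}
    (hz : Measurable z) : Measurable fun x => supp (M x) (z x) :=
  (measurable_quad hM hz).sqrt

lemma fderiv_coord {E : Type*} [NormedAddCommGroup E] [NormedSpace ℝ E] {F : E → Vec n} {x : E}
    (hF : DifferentiableAt ℝ F x) (v : E) (i : Fin n) :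
    (fderiv ℝ F x v) i = fderiv ℝ (fun y => F y i) x v := by
  have h := ((EuclideanSpace.proj (𝕜 := ℝ) i).hasFDerivAt.comp x hF.hasFDerivAt).fderiv
  exact (DFunLike.congr_fun h v).symm

lemma measurable_Amat {nx nu nw : ℕ} {f : Vec nx → Vec nw → Vec nx} {G : Vec nx → Mat nx nu}
    (hf : ContDiff ℝ 2 fun z : Vec nx × Vec nw => f z.1 z.2)
    (hG : ∀ i j, ContDiff ℝ 2 fun x => G x i j) (qw : Vec nw) {q : X → Vec nx} {u : X → Vec nu}
    (hq : Measurable q) (hu : Measurable u) (i j : Fin nx) :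
    Measurable fun x => Amat f G qw (q x) (u x) i j := by
  have hf' : ContDiff ℝ 2 fun x => f x qw := hf.comp (contDiff_id.prodMk contDiff_const)
  have hGd : ∀ i k, Differentiable ℝ fun x => G x i k := fun i k =>
    (hG i k).differentiable (by norm_num)
  have hact : ∀ (p : Vec nx) (e : Vec nu),
      (fderiv ℝ (fun x => act (G x) e) p (EuclideanSpace.single j 1)) i =
        ∑ k, fderiv ℝ (fun x => G x i k) p (EuclideanSpace.single j 1) * e k := by
    intro p e
    have hd : DifferentiableAt ℝ (fun x => act (G x) e) p := by
      refine differentiableAt_euclidean.2 fun i' => ?_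
      simp only [act_apply]
      exact DifferentiableAt.fun_sum fun k _ => (hGd i' k p).mul_const _
    rw [fderiv_coord hd]
    simp only [act_apply]
    rw [fderiv_fun_sum fun k _ => (hGd i k p).mul_const _]
    simp only [FunLike.coe_sum, Finset.sum_apply]
    refine Finset.sum_congr rfl fun k _ => ?_
    rw [fderiv_mul_const (hGd i k p)]
    simp [mul_comm]
  simp only [Amat, jacobian, Matrix.add_apply, Matrix.of_apply, hact]
  refine Measurable.add ?_ (Finset.measurable_sum _ fun k _ => Measurable.mul ?_ ?_)
  · have hc : Continuous fun x => fderiv ℝ (fun x => f x qw) x (EuclideanSpace.single j 1) :=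
      (hf'.continuous_fderiv (by norm_num)).clm_apply continuous_const
    exact measurable_coord (hc.measurable.comp hq) i
  · have hc : Continuous fun x => fderiv ℝ (fun x => G x i k) x (EuclideanSpace.single j 1) :=
      ((hG i k).continuous_fderiv (by norm_num)).clm_apply continuous_const
    exact hc.measurable.comp hq
  · exact measurable_coord hu k

lemma measurable_matDeriv (Q : ℝ → Mat m n) (i : Fin m) (j : Fin n) :
    Measurable fun t => matDeriv Q t i j :=
  measurable_deriv fun s => Q s i j

end Measurability

/-! ### Retraction onto the unit ball of the seminorm `supp Q` -/

section Retraction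

variable {n : ℕ}

/-- The radial retraction onto `{z | zᵀ Q z ≤ 1}`. -/
def retract (Q : Mat n n) (z : Vec n) : Vec n := (max 1 (supp Q z))⁻¹ • z

lemma supp_retract_le (Q : Mat n n) (z : Vec n) : supp Q (retract Q z) ≤ 1 := by
  have hpos : 0 < max 1 (supp Q z) := lt_of_lt_of_le one_pos (le_max_left _ _)
  rw [retract, supp_smul, abs_of_pos (inv_pos.2 hpos), inv_mul_le_iff₀ hpos, mul_one]
  exact le_max_right _ _

lemma retract_eq_self {Q : Mat n n} {z : Vec n} (hz : supp Q z ≤ 1) : retract Q z = z := by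
  rw [retract, max_eq_left hz, inv_one, one_smul]

lemma continuous_retract (Q : Mat n n) : Continuous (retract Q) := by
  have h := continuous_supp Q
  refine (Continuous.inv₀ (continuous_const.max h) fun z => ?_).smul continuous_id
  exact (lt_of_lt_of_le one_pos (le_max_left _ _)).ne'

lemma measurable_retract {X : Type*} [MeasurableSpace X] {M : X → Mat n n}
    (hM : ∀ i j, Measurable fun x => M x i j) (z : Vec n) :
    Measurable fun x => retract (M x) z :=
  (measurable_const.max (measurable_supp hM measurable_const)).inv.smul_const z

lemma add_act_retract_mem {Q : Mat n n} (hQ : Q.PosSemidef) (q z : Vec n) :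
    q + act Q (retract Q z) ∈ ellipsoid q Q :=
  (mem_ellipsoid_iff hQ).2 ⟨_, supp_retract_le Q z, rfl⟩

lemma exists_retract_eq {Q : Mat n n} (hQ : Q.PosSemidef) {q y : Vec n} (hy : y ∈ ellipsoid q Q) :
    ∃ z, q + act Q (retract Q z) = y := by
  obtain ⟨z, hz, rfl⟩ := (mem_ellipsoid_iff hQ).1 hy
  exact ⟨z, by rw [retract_eq_self hz]⟩

end Retraction

/-! ### Measurable parameters of nearest points -/

section NearestPoint

variable {n : ℕ}

/-- The nearest point is unique, but its parameter `z` is not when `Q` is singular, so it has to be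
selected; the admissible parameters form a convex set. -/
lemma exists_measurable_nearest {q : ℝ → Vec n} {Q : ℝ → Mat n n} (hq : Measurable q)
    (hQm : ∀ i j, Measurable fun t => Q t i j) (hQ : ∀ t, (Q t).PosSemidef) :
    ∃ z : ℝ × Vec n → Vec n, Measurable z ∧ ∀ t ξ, supp (Q t) (z (t, ξ)) ≤ 1 ∧
      ∀ y ∈ ellipsoid (q t) (Q t), ‖ξ - (q t + act (Q t) (z (t, ξ)))‖ ≤ ‖ξ - y‖ := by
  set d := TopologicalSpace.denseSeq (Vec n)
  have hQm' : ∀ i j, Measurable fun a : ℝ × Vec n => Q a.1 i j := fun i j =>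
    (hQm i j).comp measurable_fst
  have hq' : Measurable fun a : ℝ × Vec n => q a.1 := hq.comp measurable_fst
  -- Retracting a fixed dense sequence gives competitors dense in every ellipsoid and measurable in
  -- time.
  let h : ℕ → ℝ × Vec n → Vec n → ℝ := fun i a z => max (supp (Q a.1) z - 1)
    (‖a.2 - (q a.1 + act (Q a.1) z)‖ - ‖a.2 - (q a.1 + act (Q a.1) (retract (Q a.1) (d i)))‖)
  obtain ⟨z, hzm, hz⟩ := exists_measurable_selection h
    (fun i z => ((measurable_supp hQm' measurable_const).sub_const 1).max
      ((measurable_snd.sub (hq'.add (measurable_act hQm' measurable_const))).norm.sub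
        (measurable_snd.sub (hq'.add (measurable_act hQm' (measurable_retract hQm' _)))).norm))
    (fun i a => ((continuous_supp _).sub continuous_const).max
      ((continuous_const.sub (continuous_const.add (continuous_act _))).norm.sub continuous_const))
    (fun a => by
      intro z hz z' hz' α β hα hβ hαβ i
      have h1 := hz i
      have h2 := hz' i
      simp only [h, max_le_iff, sub_nonpos] at h1 h2 ⊢
      constructor
      · refine (supp_add_le (hQ _) _ _).trans ?_
        rw [supp_smul, supp_smul, abs_of_nonneg hα, abs_of_nonneg hβ]
        nlinarith [h1.1, h2.1]
      · have e : a.2 - (q a.1 + act (Q a.1) (α • z + β • z')) =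
            α • (a.2 - (q a.1 + act (Q a.1) z)) + β • (a.2 - (q a.1 + act (Q a.1) z')) := by
          have hβ' : β = 1 - α := by linarith
          subst hβ'
          simp only [act_add, act_smul]
          module
        rw [e]
        refine (norm_add_le _ _).trans ?_
        rw [norm_smul, norm_smul, Real.norm_of_nonneg hα, Real.norm_of_nonneg hβ]
        have h3 := mul_le_mul_of_nonneg_left h1.2 hα
        have h4 := mul_le_mul_of_nonneg_left h2.2 hβ
        refine (add_le_add h3 h4).trans ?_
        rw [← add_mul, hαβ, one_mul])
    (fun a => by
      obtain ⟨p, hp, hmin⟩ := exists_nearest_ellipsoid (q a.1) a.2 (Q a.1)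
      obtain ⟨z, hz, rfl⟩ := (mem_ellipsoid_iff (hQ _)).1 hp
      exact ⟨z, fun i => max_le (sub_nonpos.2 hz)
        (sub_nonpos.2 (hmin _ (add_act_retract_mem (hQ _) _ _)))⟩)
  refine ⟨z, hzm, fun t ξ => ⟨?_, fun y hy => ?_⟩⟩
  · have := (max_le_iff.1 (hz (t, ξ) 0)).1
    exact sub_nonpos.1 this
  · obtain ⟨y, rfl⟩ := exists_retract_eq (hQ t) hy
    refine (TopologicalSpace.denseRange_denseSeq (Vec n)).induction_on
      (p := fun y => ‖ξ - (q t + act (Q t) (z (t, ξ)))‖ ≤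
        ‖ξ - (q t + act (Q t) (retract (Q t) y))‖) y ?_ fun i => ?_
    · exact isClosed_le continuous_const (continuous_const.sub (continuous_const.add
        ((continuous_act _).comp (continuous_retract _)))).norm
    · exact sub_nonpos.1 (max_le_iff.1 (hz (t, ξ) i)).2

end NearestPoint

/-! ### Measurable gains -/

section MeasurableGain

variable {nx nu nw : ℕ}

/-- The matrix with a given vector of entries. -/
def toMat (k : EuclideanSpace ℝ (Fin nu × Fin nx)) : Mat nu nx := Matrix.of fun i j => k (i, j)

lemma continuous_act_toMat (c : Vec nx) :
    Continuous fun k : EuclideanSpace ℝ (Fin nu × Fin nx) => act (toMat k) c := by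
  refine continuous_vec fun i => ?_
  simp only [act_apply]
  exact continuous_finsetSum _ fun j _ =>
    (EuclideanSpace.proj (𝕜 := ℝ) (i, j)).continuous.mul continuous_const

lemma toMat_smul_add_smul_act (a b : ℝ) (k l : EuclideanSpace ℝ (Fin nu × Fin nx)) (c : Vec nx) :
    act (toMat (a • k + b • l)) c = a • act (toMat k) c + b • act (toMat l) c := by
  have : toMat (a • k + b • l) = a • toMat k + b • toMat l := rfl
  rw [this, add_act, smul_act, smul_act]

lemma exists_toMat_eq (K : Mat nu nx) : ∃ k, toMat k = K :=
  ⟨WithLp.toLp 2 fun ij => K ij.1 ij.2, rfl⟩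

/-- Both conditions are affine in `K` for fixed parameters, hence convex, and continuous in the
parameters, hence determined on a countable dense set. Pointwise existence is thus upgraded to a
measurable choice. -/
lemma exists_measurable_gain {f : Vec nx → Vec nw → Vec nx} {G : Vec nx → Mat nx nu}
    (hf : Continuous fun z : Vec nx × Vec nw => f z.1 z.2) (hG : ∀ i j, Continuous fun x => G x i j)
    {qw : Vec nw} {Qw : Mat nw nw} (hQw : Qw.PosSemidef) {qu : Vec nu} {Qu : Mat nu nu}
    {q : ℝ → Vec nx} {Q A Q' : ℝ → Mat nx nx} {ubar : ℝ → Vec nu} {v : ℝ → Vec nx}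
    (hq : Measurable q) (hQm : ∀ i j, Measurable fun t => Q t i j) (hQ : ∀ t, (Q t).PosSemidef)
    (hA : ∀ i j, Measurable fun t => A t i j) (hQ' : ∀ i j, Measurable fun t => Q' t i j)
    (hubar : Measurable ubar) (hv : Measurable v) {T : Set ℝ} (hT : MeasurableSet T)
    (hex : ∀ t ∈ T, ∃ K, AdmissibleGain qu Qu (Q t) (ubar t) K ∧
      ContractingGain f G (ellipsoid qw Qw) (q t) (Q t) (A t) (Q' t) (ubar t) (v t) K) :
    ∃ K : ℝ → Mat nu nx, (∀ i j, Measurable fun t => K t i j) ∧ ∀ t ∈ T,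
      AdmissibleGain qu Qu (Q t) (ubar t) (K t) ∧
      ContractingGain f G (ellipsoid qw Qw) (q t) (Q t) (A t) (Q' t) (ubar t) (v t) (K t) := by
  classical
  -- The parameters are `(c, e, y, η)`; retracting `y` and `η` makes `p` and `w` range over their
  -- whole ellipsoids while the parameter space does not depend on time.
  let Par := Vec nx × Vec nu × Vec nx × Vec nw
  have hrhs : ∀ (p : ℝ → Vec nx) (u : ℝ → Vec nu) (w : Vec nw), Measurable p → Measurable u →
      Measurable fun t => rhs f G (p t) (u t) w := fun p u w hp hu =>
    (hf.measurable.comp (hp.prodMk measurable_const)).add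
      (measurable_act (fun i j => (hG i j).measurable.comp hp) hu)
  have hGc : ∀ {Y : Type} [TopologicalSpace Y] {p : Y → Vec nx} {u : Y → Vec nu}, Continuous p →
      Continuous u → Continuous fun y => act (G (p y)) (u y) := by
    intro Y _ p u hp hu
    refine continuous_vec fun i => ?_
    simp only [act_apply]
    exact continuous_finsetSum _ fun j _ => ((hG i j).comp hp).mul
      ((EuclideanSpace.proj (𝕜 := ℝ) j).continuous.comp hu)
  let P : ℝ → Par → Vec nx := fun t d => q t + act (Q t) (retract (Q t) d.2.2.1)
  let w : Par → Vec nw := fun d => qw + act Qw (retract Qw d.2.2.2)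
  let h₁ : Par → ℝ → Mat nu nx → ℝ := fun d t K =>
    supp (Q t) d.1 * inner ℝ d.2.1 (ubar t - qu) + inner ℝ d.2.1 (act K d.1)
      - supp (Q t) d.1 * supp Qu d.2.1
  let h₂ : Par → ℝ → Mat nu nx → ℝ := fun d t K =>
    2 * inner ℝ d.1 (act (A t) (act (Q t) d.1)) + 2 * inner ℝ d.1 (act (G (P t d)) (act K d.1))
      + 2 * supp (Q t) d.1 *
        inner ℝ d.1 (drift f G (ubar t) (v t) (P t d) (w d) - act (A t) (P t d - q t))
      - quad (Q' t) d.1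
  have hPm : ∀ d, Measurable fun t => P t d := fun d =>
    hq.add (measurable_act hQm (measurable_retract hQm _))
  have hP : ∀ t d, P t d ∈ ellipsoid (q t) (Q t) := fun t d => add_act_retract_mem (hQ t) _ _
  have hw : ∀ d, w d ∈ ellipsoid qw Qw := fun d => add_act_retract_mem hQw _ _
  have hm₁ : ∀ d K, Measurable fun t => h₁ d t K := fun d K =>
    (((measurable_supp hQm measurable_const).mul
      (measurable_const.inner (hubar.sub_const qu))).add_const _).sub
      ((measurable_supp hQm measurable_const).mul_const _)
  have hm₂ : ∀ d K, Measurable fun t => h₂ d t K := fun d K =>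
    ((((measurable_const.inner (measurable_act hA (measurable_act hQm measurable_const))).const_mul
      2).add ((measurable_const.inner (measurable_act (fun i j => (hG i j).measurable.comp (hPm d))
        measurable_const)).const_mul 2)).add
      (((measurable_supp hQm measurable_const).const_mul 2).mul
        (measurable_const.inner (((hrhs _ _ _ (hPm d) hubar).sub hv).sub
          (measurable_act hA ((hPm d).sub hq)))))).sub (measurable_quad hQ' measurable_const)
  have hiff : ∀ t K, (∀ d, h₁ d t K ≤ 0 ∧ h₂ d t K ≤ 0) ↔ AdmissibleGain qu Qu (Q t) (ubar t) K ∧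
      ContractingGain f G (ellipsoid qw Qw) (q t) (Q t) (A t) (Q' t) (ubar t) (v t) K := by
    intro t K
    constructor
    · intro h
      refine ⟨fun c e => sub_nonpos.1 (h (c, e, 0, 0)).1, fun c p hp ω hω => ?_⟩
      obtain ⟨y, rfl⟩ := exists_retract_eq (hQ t) hp
      obtain ⟨η, rfl⟩ := exists_retract_eq hQw hω
      exact sub_nonpos.1 (h (c, 0, y, η)).2
    · rintro ⟨ha, hb⟩ d
      exact ⟨sub_nonpos.2 (ha d.1 d.2.1), sub_nonpos.2 (hb d.1 _ (hP t d) _ (hw d))⟩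
  have hcd : ∀ t K, Continuous fun d => max (h₁ d t K) (h₂ d t K) := by
    intro t K
    have c1 : Continuous fun d : Par => d.1 := continuous_fst
    have c2 : Continuous fun d : Par => d.2.1 := continuous_snd.fst
    have c3 : Continuous fun d : Par => P t d :=
      continuous_const.add ((continuous_act _).comp ((continuous_retract _).comp
        continuous_snd.snd.fst))
    have c4 : Continuous w :=
      continuous_const.add ((continuous_act _).comp ((continuous_retract _).comp
        continuous_snd.snd.snd))
    have c5 : Continuous fun d : Par => supp (Q t) d.1 := (continuous_supp _).comp c1
    refine Continuous.max ?_ ?_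
    · exact ((c5.mul (c2.inner continuous_const)).add
        (c2.inner ((continuous_act K).comp c1))).sub (c5.mul ((continuous_supp _).comp c2))
    · refine (((continuous_const.mul (c1.inner ((continuous_act _).comp
        ((continuous_act _).comp c1)))).add (continuous_const.mul (c1.inner
          (hGc c3 ((continuous_act K).comp c1))))).add ((continuous_const.mul c5).mul
          (c1.inner (Continuous.sub (Continuous.sub (Continuous.add ?_ ?_) continuous_const)
            ?_)))).sub ((continuous_quad _).comp c1)
      · exact hf.comp (c3.prodMk c4)
      · exact hGc c3 continuous_const
      · exact (continuous_act _).comp (c3.sub continuous_const)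
  set d := TopologicalSpace.denseSeq Par with hd
  have hdense : ∀ t K, (∀ i, max (h₁ (d i) t K) (h₂ (d i) t K) ≤ 0) →
      ∀ y, h₁ y t K ≤ 0 ∧ h₂ y t K ≤ 0 := by
    intro t K h y
    refine max_le_iff.1 ?_
    exact (TopologicalSpace.denseRange_denseSeq Par).induction_on
      (p := fun y => max (h₁ y t K) (h₂ y t K) ≤ 0) y
      (isClosed_le (hcd t K) continuous_const) h
  let h : ℕ → ℝ → EuclideanSpace ℝ (Fin nu × Fin nx) → ℝ := fun i t k =>
    if t ∈ T then max (h₁ (d i) t (toMat k)) (h₂ (d i) t (toMat k)) else 0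
  obtain ⟨k, hkm, hk⟩ := exists_measurable_selection h
    (fun i k => Measurable.ite hT ((hm₁ _ _).max (hm₂ _ _)) measurable_const)
    (fun i t => by
      by_cases ht : t ∈ T
      · simp only [h, if_pos ht, h₁, h₂]
        refine Continuous.max ?_ ?_
        · exact (continuous_const.add (continuous_const.inner (continuous_act_toMat _))).sub
            continuous_const
        · exact ((continuous_const.add (continuous_const.mul (continuous_const.inner
            ((continuous_act _).comp (continuous_act_toMat _))))).add continuous_const).sub
            continuous_const
      · simp only [h, if_neg ht]
        exact continuous_const)
    (fun t => by
      intro k hk l hl a b ha hb hab i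
      have h1 := hk i
      have h2 := hl i
      by_cases ht : t ∈ T
      · simp only [h, if_pos ht, max_le_iff, h₁, h₂, toMat_smul_add_smul_act, act_add, act_smul,
          inner_add_right, inner_smul_right] at h1 h2 ⊢
        have hb' : b = 1 - a := by linarith
        subst hb'
        constructor
        · have := add_le_add (mul_nonpos_of_nonneg_of_nonpos ha h1.1)
            (mul_nonpos_of_nonneg_of_nonpos hb h2.1)
          linarith
        · have := add_le_add (mul_nonpos_of_nonneg_of_nonpos ha h1.2)
            (mul_nonpos_of_nonneg_of_nonpos hb h2.2)
          linarith
      · simp [h, ht])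
    (fun t => by
      by_cases ht : t ∈ T
      · obtain ⟨K, hK⟩ := hex t ht
        obtain ⟨k, rfl⟩ := exists_toMat_eq K
        refine ⟨k, fun i => ?_⟩
        simp only [h, if_pos ht]
        exact max_le_iff.2 ((hiff t _).2 hK (d i))
      · exact ⟨0, fun i => by simp [h, ht]⟩)
  refine ⟨fun t => toMat (k t), fun i j => ?_, fun t ht => (hiff t _).1 (hdense t _ fun i => ?_)⟩
  · exact (EuclideanSpace.proj (𝕜 := ℝ) (i, j)).continuous.measurable.comp hkm
  · have := hk t i
    simpa only [h, if_pos ht] using this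

end MeasurableGain

end

end EllTube

/-! ### Construction of the feedback and proof of the theorem -/

open EllTube in
theorem theorem3 {nx nu nw : ℕ}
    (f : EllTube.Vec nx → EllTube.Vec nw → EllTube.Vec nx)
    (G : EllTube.Vec nx → EllTube.Mat nx nu)
    (U : Set (EllTube.Vec nu)) (W : Set (EllTube.Vec nw))
    (t₁ t₂ : ℝ) (ht : t₁ ≤ t₂)
    -- ellipsoidal bounds on the disturbance and control sets
    (qw : EllTube.Vec nw) (Qw : EllTube.Mat nw nw) (hQw : Qw.PosSemidef)
    (hW : W ⊆ EllTube.ellipsoid qw Qw)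
    (qu : EllTube.Vec nu) (Qu : EllTube.Mat nu nu) (hQu : Qu.PosSemidef)
    (hU : EllTube.ellipsoid qu Qu ⊆ U)
    -- `f` and `G` are twice continuously differentiable
    (hf : ContDiff ℝ 2 (fun z : EllTube.Vec nx × EllTube.Vec nw => f z.1 z.2))
    (hG : ∀ i j, ContDiff ℝ 2 (fun x => G x i j))
    -- the reference control and the inner ellipsoids `E(u_x(t), R_u(t))`
    (ux : ℝ → EllTube.Vec nu) (hux : EllTube.IsSignal t₁ t₂ U ux)
    (hux' : ∀ t ∈ Set.Icc t₁ t₂, ux t ∈ EllTube.ellipsoid qu Qu)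
    (γ : ℝ → ℝ) (hγ : ∀ t ∈ Set.Icc t₁ t₂, 0 < γ t ∧ γ t ≤ 1)
    (Ru : ℝ → EllTube.Mat nu nu) (hRu : ∀ t ∈ Set.Icc t₁ t₂, (Ru t).PosSemidef)
    (hRu' : ∀ t ∈ Set.Icc t₁ t₂, Ru t = EllTube.innerShape qu Qu (γ t) (ux t))
    -- center and shape matrix of the tube
    (qx : ℝ → EllTube.Vec nx) (hqx : AbsolutelyContinuousOnInterval qx t₁ t₂)
    (Qx : ℝ → EllTube.Mat nx nx)
    (hQx : ∀ i j, AbsolutelyContinuousOnInterval (fun t => Qx t i j) t₁ t₂)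
    (hQx' : ∀ t ∈ Set.Icc t₁ t₂, (Qx t).PosSemidef)
    -- nonlinearity bounders; control perturbations are measured from `u_x(t)` or from `q_u`
    (ubar : ℝ → EllTube.Vec nu) (hubar : ubar = ux ∨ ubar = fun _ => qu)
    (Ωn : EllTube.Vec nx → EllTube.Mat nx nx → EllTube.Mat nx nx)
    (hΩn : EllTube.IsRemainderBounder f G qw Qw Qu t₁ t₂ ux ubar qx Qx Ωn)
    (ΩG : EllTube.Vec nx → EllTube.Mat nx nx → EllTube.Mat nu nu → EllTube.Mat nx nu →
      EllTube.Mat nx nx)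
    (hΩG : EllTube.IsInputBounder G t₁ t₂ qx Qx Ru ΩG)
    -- the scaling functions and the contraction-valued function `S`
    (lam kap : ℝ → ℝ) (hlam : ∀ t ∈ Set.Icc t₁ t₂, 0 < lam t)
    (hkap : ∀ t ∈ Set.Icc t₁ t₂, 0 < kap t)
    (S : ℝ → EllTube.Mat nx nu)
    (hS : ∀ t ∈ Set.Icc t₁ t₂, EllTube.Loewner (S t * (S t)ᵀ) 1)
    -- the nominal ODE and the matrix differential inequality
    (hode : ∀ᵐ t : ℝ, t ∈ Set.Icc t₁ t₂ →
      HasDerivAt qx (EllTube.rhs f G (qx t) (ux t) qw) t)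
    (hineq : ∀ᵐ t : ℝ, t ∈ Set.Icc t₁ t₂ →
      EllTube.Loewner
        (EllTube.Phi f G qw Qw Ωn ΩG (ux t) (qx t) (Qx t) (S t) (Ru t) (lam t) (kap t))
        (EllTube.matDeriv Qx t)) :
    EllTube.IsRFIT f G U W t₁ t₂ (fun t => EllTube.ellipsoid (qx t) (Qx t)) := by
  classical
  -- measurable versions of the data on the whole line
  obtain ⟨uM, huM, huM_eq⟩ : ∃ uM : ℝ → Vec nu, Measurable uM ∧
      ∀ᵐ t, t ∈ Set.Icc t₁ t₂ → uM t = ux t := by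
    obtain ⟨g, hg, hge⟩ := hux.1.aestronglyMeasurable.aemeasurable
    refine ⟨g, hg, ?_⟩
    filter_upwards [(MeasureTheory.ae_restrict_iff' measurableSet_Icc).1 hge] with t h ht
    exact (h ht).symm
  obtain ⟨bM, hbM, hbM_eq⟩ : ∃ bM : ℝ → Vec nu, Measurable bM ∧
      ∀ᵐ t, t ∈ Set.Icc t₁ t₂ → bM t = ubar t := by
    rcases hubar with rfl | rfl
    · exact ⟨uM, huM, huM_eq⟩
    · exact ⟨fun _ => qu, measurable_const, Filter.Eventually.of_forall fun _ _ => rfl⟩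
  have hubar_mem : ∀ t ∈ Set.Icc t₁ t₂, ubar t ∈ ellipsoid qu Qu := fun t h => by
    rcases hubar with rfl | rfl
    · exact hux' t h
    · exact center_mem_ellipsoid _ _
  have hubar_or : ∀ t, ubar t = ux t ∨ ubar t = qu := fun t => by
    rcases hubar with rfl | rfl
    · exact Or.inl rfl
    · exact Or.inr rfl
  -- Freezing the data at the endpoints makes it measurable, with positive semidefinite shape, on
  -- the whole line.
  set q : ℝ → Vec nx := fun t => qx (Set.projIcc t₁ t₂ ht t) with hq
  set Q : ℝ → Mat nx nx := fun t => Qx (Set.projIcc t₁ t₂ ht t) with hQ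
  have hq_eq : ∀ t ∈ Set.Icc t₁ t₂, q t = qx t := fun t h => by
    simp only [hq, Set.projIcc_of_mem ht h]
  have hQ_eq : ∀ t ∈ Set.Icc t₁ t₂, Q t = Qx t := fun t h => by
    simp only [hQ, Set.projIcc_of_mem ht h]
  have hqm : Measurable q := by
    have := hqx.continuousOn
    rw [Set.uIcc_of_le ht] at this
    exact (this.domRestrict.comp continuous_projIcc).measurable
  have hQm : ∀ i j, Measurable fun t => Q t i j := fun i j => by
    have := (hQx i j).continuousOn
    rw [Set.uIcc_of_le ht] at this
    exact (this.domRestrict.comp continuous_projIcc).measurable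
  have hQpsd : ∀ t, (Q t).PosSemidef := fun t => hQx' _ (Set.projIcc t₁ t₂ ht t).2
  -- a measurable set of full measure on which all conditions hold
  obtain ⟨T, hTm, hTsub, hTae, hTu, hTb, hTineq⟩ : ∃ T : Set ℝ, MeasurableSet T ∧
      T ⊆ Set.Icc t₁ t₂ ∧ (∀ᵐ t, t ∈ Set.Icc t₁ t₂ → t ∈ T) ∧ (∀ t ∈ T, uM t = ux t) ∧
      (∀ t ∈ T, bM t = ubar t) ∧ (∀ t ∈ T, Loewner
        (Phi f G qw Qw Ωn ΩG (ux t) (qx t) (Qx t) (S t) (Ru t) (lam t) (kap t))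
        (matDeriv Qx t)) := by
    obtain ⟨N, hN, hNm, hNnull⟩ := MeasureTheory.exists_measurable_superset_of_null
      (MeasureTheory.ae_iff.1 ((huM_eq.and hbM_eq).and hineq))
    have hgood : ∀ t ∈ Set.Icc t₁ t₂ \ N, _ := fun t h => not_not.1 fun hn => h.2 (hN hn)
    refine ⟨Set.Icc t₁ t₂ \ N, measurableSet_Icc.diff hNm, Set.sdiff_subset, ?_,
      fun t h => (hgood t h).1.1 h.1, fun t h => (hgood t h).1.2 h.1, fun t h => (hgood t h).2 h.1⟩
    filter_upwards [MeasureTheory.measure_eq_zero_iff_ae_notMem.1 hNnull] with t h1 h2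
    exact ⟨h2, h1⟩
  have hn : ∀ t ∈ Set.Icc t₁ t₂, ∀ ξ ∈ ellipsoid 0 (Qx t), ∀ ω ∈ ellipsoid 0 Qw,
      remainder f G qw (qx t) (ux t) (ubar t) ξ ω 0 ∈ ellipsoid 0 (Ωn (qx t) (Qx t)) :=
    fun t h ξ hξ ω hω => hΩn.2 t h ξ hξ ω hω 0 (center_mem_ellipsoid _ _)
  have hrhs := (contDiff_rhs hf hG).continuous
  obtain ⟨K, hKm, hK⟩ := exists_measurable_gain hf.continuous (fun i j => (hG i j).continuous) hQw
    (qw := qw) (qu := qu) (Qu := Qu) hqm hQm hQpsd (fun i j => measurable_Amat hf hG qw hqm huM i j)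
    (fun i j => measurable_matDeriv Qx i j) hbM
    (v := fun t => rhs f G (q t) (uM t) qw)
    (hrhs.measurable.comp (hqm.prodMk (huM.prodMk measurable_const))) hTm (fun t hT => by
      have h := hTsub hT
      rw [hq_eq t h, hQ_eq t h, hTu t hT, hTb t hT]
      refine ⟨gain (Qx t) (S t) (Ru t), ?_, ?_⟩
      · have hR := hRu t h
        rw [hRu' t h] at hR ⊢
        exact admissibleGain_gain hQu (hγ t h).1 (hγ t h).2 (hux' t h) (hubar_or t) hR (hQx' t h)
          (hS t h)
      · exact contractingGain_gain (hQx' t h) hQw (hΩn.1 _ _ (hQx' t h)) (hn t h)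
          (fun p hp => hΩG.2 t h p hp _ (hS t h)) (hlam t h) (hkap t h) (hTineq t hT))
  obtain ⟨z, hzm, hz⟩ := exists_measurable_nearest hqm hQm hQpsd
  have hmem : ∀ t ∈ T, ∀ ξ, bM t + act (K t) (z (t, ξ)) ∈ ellipsoid qu Qu := fun t hT ξ =>
    (hK t hT).1.add_mem_ellipsoid hQu (by rw [hTb t hT]; exact hubar_mem t (hTsub hT)) (hz t ξ).1
  -- Off `T` the value `qu` keeps the feedback in the compact control ellipsoid, which gives
  -- admissibility and integrability at every time.
  set μ : ℝ → Vec nx → Vec nu := fun t ξ => if t ∈ T then bM t + act (K t) (z (t, ξ)) else qu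
    with hμ
  have hμ_mem : ∀ t ξ, μ t ξ ∈ ellipsoid qu Qu := fun t ξ => by
    simp only [hμ]
    split_ifs with hT
    · exact hmem t hT ξ
    · exact center_mem_ellipsoid _ _
  have hμm : Measurable (Function.uncurry μ) :=
    Measurable.ite (measurable_fst hTm) ((hbM.comp measurable_fst).add
      (measurable_act (fun i j => (hKm i j).comp measurable_fst) hzm)) measurable_const
  refine ⟨μ, ⟨hμm, fun ξ => ?_, fun t _ ξ => hU (hμ_mem t ξ)⟩, ?_⟩
  · obtain ⟨C, hC⟩ := (isCompact_ellipsoid qu Qu).isBounded.exists_norm_le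
    exact MeasureTheory.Measure.integrableOn_of_bounded (M := C) (by simp)
      (hμm.comp (measurable_id.prodMk measurable_const)).aestronglyMeasurable
      (Filter.Eventually.of_forall fun t => hC _ (hμ_mem t ξ))
  · intro w hw s hs s' hs' hss' x hx hxs
    refine mem_ellipsoid_of_isClosedLoopSolution hf hG hQu hqx hQx hQx' hux' hubar_mem hode
      (A := fun t => Amat f G qw (qx t) (ux t)) (K := K) (z := fun t ξ => z (t, ξ)) (μ := μ)
      (qw := qw) (Qw := Qw) ?_ ?_ ?_ ?_ ?_ (fun t h => hW (hw.2 t h)) hs hs' hss' hx hxs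
    · intro t h ξ
      rw [← hq_eq t h, ← hQ_eq t h]
      exact hz t ξ
    · filter_upwards [hTae] with t h1 h2
      have := (hK t (h1 h2)).1
      rwa [hQ_eq t h2, hTb t (h1 h2)] at this
    · filter_upwards [hTae] with t h1 h2
      have := (hK t (h1 h2)).2
      rwa [hQ_eq t h2, hq_eq t h2, hTb t (h1 h2), hTu t (h1 h2)] at this
    · filter_upwards [hTae, ae_hasMatDerivAt hQx ht] with t h1 h3 h4
      have h2 := Set.Ioo_subset_Icc_self h4
      refine driftCompatible_of_loewner (hQx' t h2) hQw (hΩn.1 _ _ (hQx' t h2)) (hn t h2)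
        (hΩG.1 _ _ _ _ (hQx' t h2) (hRu t h2)) (hlam t h2) (hkap t h2) (hTineq t (h1 h2))
        fun c hc => (h3 h2).quad_eq_zero ?_ hc
      filter_upwards [Icc_mem_nhds h4.1 h4.2] with τ hτ using hQx' τ hτ
    · filter_upwards [hTae] with t h1 h2 ξ
      simp only [hμ, if_pos (h1 h2), hTb t (h1 h2)]
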